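/- Let $V$ be a real vector space of dimension $n+2$ with a scalar product $\langle\cdot,\cdot\rangle$ (a non-degenerate symmetric bilinear form) of index one, i.e. with Gram matrix $\mathrm{diag}(1,\dots,1,-1)$ in a suitable basis. Call a subspace of $V$ euclidean if the scalar product is positive definite on it (the zero subspace is allowed), pseudo-euclidean if the restricted scalar product is non-degenerate of index one, and isotropic if the restricted scalar product is degenerate with one-dimensional radical. The Möbius space $S^n$ is the set of points $[x]$ of the projective space $\mathbb P(V)$ with $\langle x,x\rangle=0$; the Möbius group $G_n$ is the group of all projective transformations of $\mathbb P(V)$ that preserve $S^n$. For $k\ge 0$, a $k$-sphere is the intersection of $S^n$ with (the projectivization of) a pseudo-euclidean subspace of dimension $k+2$; a hypersphere is an $(n-1)$-sphere. Let $n>m\ge l\ge 0$. Let $S_1^m$ be an $m$-sphere and $S_2^l$ an $l$-sphere, defined by the pseudo-euclidean subspaces $W$ ($\dim W=m+2$) and $U$ ($\dim U=l+2$), and suppose that the pair is in general position: no hypersphere contains $S_1\cup S_2$. Let $p_{2,1}\colon W^\perp\to U^\perp$ and $p_{1,2}\colon U^\perp\to W^\perp$ be the restrictions of the orthogonal projections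 belonging to $V=U\oplus U^\perp=W\oplus W^\perp$, and $A=p_{1,2}\circ p_{2,1}\in\mathrm{End}(W^\perp)$. The subspheres are called separable by hyperspheres if there are hyperspheres $\Sigma_1\supseteq S_1$ and $\Sigma_2\supseteq S_2$ with $\Sigma_1\cap\Sigma_2=\emptyset$ (and, if $n=1$, where hyperspheres are pairs of points of a circle, such that moreover $\Sigma_2$ lies in one of the two arcs of $S^1\setminus\Sigma_1$); they are called interlaced if $S_1\cap S_2=\emptyset$ and they are not separable by hyperspheres. **Theorem.** (a) $A$ is self-adjoint, and $W^\perp$ has an orthonormal basis of eigenvectors of $A$; its eigenvalues, counted with multiplicity, are $\alpha_1\ge\alpha_2\ge\dots\ge\alpha_{n-m}\ge 0$. (b) These eigenvalues are a complete system of Möbius invariants: if $(S_1^m,S_2^l)$ and $(\hat S_1^m,\hat S_2^l)$ are two pairs in general position, with eigenvalues $\alpha_i$ and $\hat\alpha_i$, then there is a $g\in G_n$ with $gS_1=\hat S_1$ and $gS_2=\hat S_2$ if and only if $\alpha_i=\hat\alpha_i$ for $i=1,\dots,n-m$. (c) The mutual position of the spheres is determined by $\alpha_1$ and $\dim(U\cap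 W)$: 1. $\alpha_1>1$ $\iff$ $U\cap W$ is euclidean $\iff$ $S_1,S_2$ are separable by hyperspheres; 2. $\alpha_1<1$ and $\dim(U\cap W)>1$ $\iff$ $U\cap W$ is pseudo-euclidean of dimension $\ge2$ $\iff$ $S_1\cap S_2$ is a $k$-sphere for some $k\ge0$; in this case it is a $k$-sphere with $k=m+l-n$; 3. $\alpha_1<1$ and $\dim(U\cap W)=1$ $\iff$ $U\cap W$ is pseudo-euclidean of dimension $1$ $\iff$ $S_1,S_2$ are interlaced; in this case $m+l=n-1$; 4. $\alpha_1=1$ $\iff$ $U\cap W$ is isotropic $\iff$ $S_1\cap S_2$ consists of exactly one point. Moreover, $\alpha_1<1$ if and only if $U\cap W$ is pseudo-euclidean, so that these four cases exhaust all pairs in general position. -/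

import Mathlib

open scoped LinearAlgebra.Projectivization Pointwise

noncomputable section

namespace Moebius

variable {V : Type*} [AddCommGroup V] [Module ℝ V]

/-- A pseudo-euclidean scalar product of index one: there is a basis whose Gram matrix is
`diag (1, …, 1, -1)`. Such a form is symmetric and non-degenerate. -/
def IsPseudoEuclidean (B : LinearMap.BilinForm ℝ V) : Prop :=
  ∃ (k : ℕ) (b : Module.Basis (Fin (k + 1)) ℝ V), ∀ i j,
    B (b i) (b j) = if i = j then (if i = Fin.last k then -1 else 1) else 0

/-- The restriction of the scalar product to `W` is positive definite (`W = 0` is allowed). -/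
def EuclideanOn (B : LinearMap.BilinForm ℝ V) (W : Submodule ℝ V) : Prop :=
  ∀ x ∈ W, x ≠ 0 → 0 < B x x

/-- The restriction of the scalar product to `W` is pseudo-euclidean of index one. -/
def PseudoEuclideanOn (B : LinearMap.BilinForm ℝ V) (W : Submodule ℝ V) : Prop :=
  IsPseudoEuclidean (B.restrict W)

/-- The restriction of the scalar product to `W` is degenerate, of rank `dim W - 1`. -/
def IsotropicOn (B : LinearMap.BilinForm ℝ V) (W : Submodule ℝ V) : Prop :=
  Module.finrank ℝ ↥(W ⊓ B.orthogonal W) = 1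

/-- The Möbius space: the set of the isotropic points of the projective space. -/
def quadric (B : LinearMap.BilinForm ℝ V) : Set (ℙ ℝ V) :=
  {p | ∀ x ∈ p.submodule, B x x = 0}

/-- The Möbius group: the projective transformations that preserve the Möbius space. -/
def moebiusGroup (B : LinearMap.BilinForm ℝ V) : Subgroup (Equiv.Perm (ℙ ℝ V)) :=
  (MulAction.toPermHom (V ≃ₗ[ℝ] V) (ℙ ℝ V)).range ⊓
    MulAction.stabilizer (Equiv.Perm (ℙ ℝ V)) (quadric B)

/-- An `m`-sphere, given by its pseudo-euclidean subspace of dimension `m + 2`. -/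
structure Subsphere (B : LinearMap.BilinForm ℝ V) (m : ℕ) where
  space : Submodule ℝ V
  pseudoEuclidean : PseudoEuclideanOn B space
  finrank_eq : Module.finrank ℝ space = m + 2

namespace Subsphere

variable {B : LinearMap.BilinForm ℝ V} {m l : ℕ}

/-- The points of the sphere. -/
def points (S : Subsphere B m) : Set (ℙ ℝ V) :=
  {p | p ∈ quadric B ∧ p.submodule ≤ S.space}

/-- The orthogonal complement of the subspace defining the sphere. -/
abbrev perp (S : Subsphere B m) : Submodule ℝ V := B.orthogonal S.space

theorem isCompl (S : Subsphere B m) : IsCompl S.perp S.space := by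
  obtain ⟨k, b, hb⟩ := S.pseudoEuclidean
  have hb' : ∀ i j, B (b i : V) (b j : V) =
      if i = j then (if i = Fin.last k then -1 else 1) else 0 := hb
  have key : ∀ v : V, (∀ i, B (b i : V) v = 0) → v ∈ S.perp := by
    intro v hv x hx
    have h : (B.flip v) ∘ₗ S.space.subtype = 0 := b.ext fun i => by simpa using hv i
    exact LinearMap.congr_fun h ⟨x, hx⟩
  refine ⟨Submodule.disjoint_def.2 fun x hx hxW => ?_, codisjoint_iff.2 ?_⟩
  · have h1 : ∀ i, b.repr ⟨x, hxW⟩ i = 0 := by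
      intro i
      have h2 : B (b i : V) x = 0 := hx _ (b i).2
      have h3 : x = ∑ j, b.repr ⟨x, hxW⟩ j • (b j : V) := by
        have h5 := congrArg S.space.subtype (b.sum_repr ⟨x, hxW⟩)
        rw [map_sum] at h5
        simp only [map_smul, Submodule.subtype_apply] at h5
        exact h5.symm
      rw [h3, map_sum] at h2
      simp only [map_smul, hb', smul_eq_mul, mul_ite, mul_zero, Finset.sum_ite_eq,
        Finset.mem_univ, if_true] at h2
      split_ifs at h2 <;> simpa using h2
    have h0 : (⟨x, hxW⟩ : S.space) = 0 := by
      apply b.repr.injective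
      ext i
      simpa using h1 i
    exact congrArg Subtype.val h0
  · refine eq_top_iff.2 fun v _ => ?_
    let w : V := ∑ j, ((if j = Fin.last k then (-1 : ℝ) else 1) * B (b j : V) v) • (b j : V)
    have hw : w ∈ S.space := Submodule.sum_mem _ fun j _ => Submodule.smul_mem _ _ (b j).2
    refine Submodule.mem_sup.2 ⟨v - w, key _ fun i => ?_, w, hw, by abel⟩
    have h4 : B (b i : V) w = B (b i : V) v := by
      simp only [w, map_sum, map_smul, hb', smul_eq_mul, mul_ite, mul_zero, Finset.sum_ite_eq,
        Finset.mem_univ, if_true]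
      split_ifs <;> ring
    rw [map_sub, h4, sub_self]

/-- The projection `S₁.perp → S₂.perp`: the restriction to `S₁.perp` of the projection of
`V = S₂.perp ⊕ S₂.space` onto `S₂.perp`. -/
def proj (S₁ : Subsphere B m) (S₂ : Subsphere B l) : S₁.perp →ₗ[ℝ] S₂.perp :=
  (S₂.perp.projectionOnto S₂.space S₂.isCompl) ∘ₗ S₁.perp.subtype

/-- The operator `A = p₁₂ ∘ p₂₁` on the orthogonal complement of the space of `S₁`. -/
def opA (S₁ : Subsphere B m) (S₂ : Subsphere B l) : Module.End ℝ S₁.perp :=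
  proj S₂ S₁ ∘ₗ proj S₁ S₂

/-- The eigenvalues of `A`, repeated by (algebraic) multiplicity and in decreasing order, numbered
from `0`, so that `eigenvalue S₁ S₂ 0` is the largest one. -/
def eigenvalue [FiniteDimensional ℝ V] (S₁ : Subsphere B m) (S₂ : Subsphere B l) (i : ℕ) : ℝ :=
  ((opA S₁ S₂).charpoly.roots.sort (· ≥ ·)).getD i 0

/-- In the `n`-dimensional Möbius space: no hypersphere contains both spheres. -/
def GeneralPosition (n : ℕ) (S₁ : Subsphere B m) (S₂ : Subsphere B l) : Prop :=
  ¬ ∃ H : Subsphere B (n - 1), S₁.points ∪ S₂.points ⊆ H.points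

/-- The sphere `S` lies on one side of the hypersphere `H`. Two isotropic vectors `x`, `y` with
`B x y < 0` belong to the same half of the light cone; the points `[x]`, `[y]` are then strictly
on different sides of the hypersphere with normal vector `v` iff `B v x` and `B v y` have
opposite signs. -/
def OnOneSide (H : Subsphere B m) (S : Subsphere B l) : Prop :=
  ∀ v ∈ H.perp, ∀ x ∈ S.space, ∀ y ∈ S.space, B x x = 0 → B y y = 0 → B x y < 0 →
    0 ≤ B v x * B v y

/-- In the `n`-dimensional Möbius space: there are disjoint hyperspheres `H₁ ⊇ S₁`, `H₂ ⊇ S₂`.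
For `n = 1`, where the hyperspheres are pairs of points and hence not connected, `H₂` has to lie
in one of the two arcs bounded by `H₁`. -/
def Separable (n : ℕ) (S₁ : Subsphere B m) (S₂ : Subsphere B l) : Prop :=
  ∃ H₁ H₂ : Subsphere B (n - 1), S₁.points ⊆ H₁.points ∧ S₂.points ⊆ H₂.points ∧
    H₁.points ∩ H₂.points = ∅ ∧ (n = 1 → OnOneSide H₁ H₂)

/-- The spheres are disjoint, but not separable by hyperspheres. -/
def Interlaced (n : ℕ) (S₁ : Subsphere B m) (S₂ : Subsphere B l) : Prop :=
  S₁.points ∩ S₂.points = ∅ ∧ ¬ Separable n S₁ S₂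

/-- Equivalence of pairs of spheres under the Möbius group. -/
def MoebiusEquivalent (S₁ : Subsphere B m) (S₂ : Subsphere B l)
    (T₁ : Subsphere B m) (T₂ : Subsphere B l) : Prop :=
  ∃ g ∈ moebiusGroup B, g '' S₁.points = T₁.points ∧ g '' S₂.points = T₂.points

end Subsphere

end Moebius

end

open Moebius Moebius.Subsphere

/-!
Hyperspheres are the intersections of the Möbius space with the hyperplanes orthogonal to a
spacelike vector. Hence general position of `S₁` and `S₂`, with spaces `W` and `U`, says that the
euclidean spaces `W⊥` and `U⊥` meet in `0`. For `x` in `W⊥` the vector `y = x - p₂₁ x` lies in `U`,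
so it is orthogonal to `U⊥`, and `⟨y, y⟩ = ⟨x, x⟩ - ⟨A x, x⟩`. Thus `(U ⊓ W)⊥ = U⊥ ⊔ W⊥` is the
orthogonal sum of `U⊥` and a space on which the scalar product is that of `1 - A`. According to the
sign of `1 - α₁` it is euclidean, isotropic or pseudo-euclidean, and `U ⊓ W` is then
pseudo-euclidean, isotropic or euclidean. The points of `S₁ ∩ S₂` are the null lines of `U ⊓ W`.
A timelike vector of `(U ⊓ W)⊥` is a sum `v₂ + v₁` with `v₂` in `U⊥` and `v₁` in `W⊥`; the
hyperspheres with these normal vectors separate `S₁` from `S₂`.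

If two pairs have the same eigenvalues, there is an isometry `W⊥ ≃ Ŵ⊥` carrying `A` to `Â`. Since
`⟨p₂₁ x, p₂₁ y⟩ = ⟨A x, y⟩`, it comes with an isometry `U⊥ ≃ Û⊥` compatible with the projections,
and Witt's theorem extends the two to `V`. Conversely, a quadratic form that vanishes on the light
cone is a multiple of the scalar product, so Möbius transformations come from similarities of `V`,
and these conjugate the operators `A`.
-/

namespace Moebius

/-! ### Forms of index one -/

section OrthogonalBasis

variable {R M ι : Type*} [CommSemiring R] [AddCommMonoid M] [Module R M] [Fintype ι]
  [DecidableEq ι] {B : LinearMap.BilinForm R M} {b : Module.Basis ι R M} {d : ι → R}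

theorem apply_eq_sum_mul_repr (hb : ∀ i j, B (b i) (b j) = if i = j then d i else 0) (x y : M) :
    B x y = ∑ i, d i * (b.repr x i * b.repr y i) := by
  rw [← LinearMap.sum_repr_mul_repr_mul b b, Finsupp.sum_fintype _ _ (by simp)]
  refine Finset.sum_congr rfl fun i _ => ?_
  rw [Finsupp.sum_fintype _ _ (by simp), Finset.sum_eq_single_of_mem i (Finset.mem_univ i)]
  · simp only [hb, if_true, smul_eq_mul]
    ring
  · intro j _ hj
    simp [hb, hj.symm]

end OrthogonalBasis

section PositiveDefinite

variable {E : Type*} [AddCommGroup E] [Module ℝ E] {B : LinearMap.BilinForm ℝ E}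

theorem apply_lt_of_orthonormal_eigenbasis {ι : Type*} [Finite ι] [DecidableEq ι]
    {a : Module.Basis ι ℝ E} (ha : ∀ i j, B (a i) (a j) = if i = j then 1 else 0)
    {T : Module.End ℝ E} {α : ι → ℝ} (hT : ∀ i, T (a i) = α i • a i) {c : ℝ} (hα : ∀ i, α i < c)
    {x : E} (hx : x ≠ 0) : B (T x) x < c * B x x := by
  have := Fintype.ofFinite ι
  have hrepr : ∀ i, a.repr (T x) i = α i * a.repr x i := fun i => by
    have h : Finsupp.lapply i ∘ₗ a.repr.toLinearMap ∘ₗ T =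
        α i • (Finsupp.lapply i ∘ₗ a.repr.toLinearMap) := a.ext fun j => by
      by_cases hij : j = i <;> simp [hT, hij]
    exact LinearMap.congr_fun h x
  obtain ⟨i, hi⟩ := Finsupp.ne_iff.1 (a.repr.map_ne_zero_iff.2 hx)
  rw [apply_eq_sum_mul_repr ha, apply_eq_sum_mul_repr ha, Finset.mul_sum]
  refine Finset.sum_lt_sum (fun j _ => ?_) ⟨i, Finset.mem_univ i, ?_⟩
  · rw [hrepr]
    nlinarith [mul_nonneg (sub_nonneg.2 (hα j).le) (mul_self_nonneg (a.repr x j))]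
  · rw [hrepr]
    nlinarith [mul_pos (sub_pos.2 (hα i)) (mul_self_pos.2 hi)]

variable [FiniteDimensional ℝ E]

theorem exists_orthonormal_eigenbasis (hs : B.IsSymm) (hp : ∀ x, x ≠ 0 → 0 < B x x)
    {T : Module.End ℝ E} (hT : ∀ x y, B (T x) y = B x (T y))
    {N : ℕ} (hN : Module.finrank ℝ E = N) :
    ∃ (a : Module.Basis (Fin N) ℝ E) (α : Fin N → ℝ), Antitone α ∧
      (∀ i j, B (a i) (a j) = if i = j then 1 else 0) ∧ (∀ i, T (a i) = α i • a i) ∧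
      T.charpoly.roots.sort (· ≥ ·) = List.ofFn α := by
  let core : InnerProductSpace.Core ℝ E :=
    { inner := fun x y => B x y
      conj_inner_symm := fun x y => by simpa using hs.eq y x
      re_inner_nonneg := fun x => by
        by_cases hx : x = 0
        · simp [hx]
        · simpa using (hp x hx).le
      add_left := fun x y z => by simp
      smul_left := fun x y r => by simp
      definite := fun x hx => by
        by_contra h
        exact (hp x h).ne' hx }
  let : NormedAddCommGroup E := core.toNormedAddCommGroup
  let : InnerProductSpace ℝ E := InnerProductSpace.ofCore core.toCore
  have hTs : T.IsSymmetric := hT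
  refine ⟨(hTs.eigenvectorBasis hN).toBasis, hTs.eigenvalues hN, hTs.eigenvalues_antitone hN,
    fun i j => ?_, fun i => ?_, ?_⟩
  · rw [OrthonormalBasis.coe_toBasis]
    exact orthonormal_iff_ite.1 (hTs.eigenvectorBasis hN).orthonormal i j
  · simp
  · simpa using hTs.sort_roots_charpoly_eq_eigenvalues hN

theorem exists_orthonormal_basis (hs : B.IsSymm) (hp : ∀ x, x ≠ 0 → 0 < B x x)
    {N : ℕ} (hN : Module.finrank ℝ E = N) :
    ∃ a : Module.Basis (Fin N) ℝ E, ∀ i j, B (a i) (a j) = if i = j then 1 else 0 := by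
  obtain ⟨a, -, -, ha, -⟩ := exists_orthonormal_eigenbasis hs hp (T := 0) (by simp) hN
  exact ⟨a, ha⟩

end PositiveDefinite

section IndexOne

variable {V : Type*} [AddCommGroup V] [Module ℝ V] {B : LinearMap.BilinForm ℝ V}

namespace IsPseudoEuclidean

theorem isSymm (hB : IsPseudoEuclidean B) : B.IsSymm := by
  obtain ⟨k, b, hb⟩ := hB
  refine (LinearMap.BilinForm.isSymm_iff_basis b).2 fun i j => ?_
  rcases eq_or_ne i j with rfl | hij
  · rfl
  · rw [hb, hb, if_neg hij, if_neg hij.symm]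

theorem isRefl (hB : IsPseudoEuclidean B) : B.IsRefl := hB.isSymm.isRefl

theorem exists_timelike_orthogonal_pos (hB : IsPseudoEuclidean B) :
    ∃ t, B t t < 0 ∧ ∀ x, B t x = 0 → x ≠ 0 → 0 < B x x := by
  obtain ⟨k, b, hb⟩ := hB
  refine ⟨b (Fin.last k), by simp [hb], fun x hx hx0 => ?_⟩
  have hlast : b.repr x (Fin.last k) = 0 := by
    simpa [apply_eq_sum_mul_repr hb, Finsupp.single_apply] using hx
  have hsq : ∀ i, (if i = Fin.last k then (-1 : ℝ) else 1) * (b.repr x i * b.repr x i) =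
      b.repr x i ^ 2 := fun i => by
    split_ifs with h
    · simp [h, hlast]
    · ring
  obtain ⟨i, hi⟩ := Finsupp.ne_iff.1 (b.repr.map_ne_zero_iff.2 hx0)
  simp only [apply_eq_sum_mul_repr hb, hsq]
  exact Finset.sum_pos' (fun _ _ => sq_nonneg _) ⟨i, Finset.mem_univ i, sq_pos_of_ne_zero hi⟩

theorem exists_smul_eq_of_nonpos (hB : IsPseudoEuclidean B) {x y : V} (hx : B x x ≤ 0)
    (hy : B y y ≤ 0) (hxy : B x y = 0) (hx0 : x ≠ 0) : ∃ c : ℝ, c • x = y := by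
  obtain ⟨s, -, hs⟩ := hB.exists_timelike_orthogonal_pos
  have hsx : B s x ≠ 0 := fun h => (hs x h hx0).not_ge hx
  refine ⟨B s y / B s x, ?_⟩
  by_contra hne
  have hpos := hs ((B s y / B s x) • x - y) (by simp [hsx]) (sub_ne_zero.2 hne)
  simp only [map_sub, map_smul, LinearMap.sub_apply, LinearMap.smul_apply, smul_eq_mul, hxy,
    hB.isSymm.eq y x] at hpos
  nlinarith [mul_nonneg (sq_nonneg (B s y / B s x)) (neg_nonneg.2 hx)]

theorem pos_of_orthogonal_timelike (hB : IsPseudoEuclidean B) {t x : V} (ht : B t t < 0)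
    (htx : B t x = 0) (hx : x ≠ 0) : 0 < B x x := by
  by_contra! hx'
  obtain ⟨c, rfl⟩ := hB.exists_smul_eq_of_nonpos ht.le hx' htx (by rintro rfl; simp at ht)
  have hc : c = 0 := by simpa [ht.ne] using htx
  simp [hc] at hx

theorem nondegenerate (hB : IsPseudoEuclidean B) : B.Nondegenerate := by
  refine (LinearMap.IsRefl.nondegenerate_iff_separatingLeft hB.isRefl).2 fun x hx => ?_
  obtain ⟨t, -, hpos⟩ := hB.exists_timelike_orthogonal_pos
  by_contra hx0
  exact (hpos x (hB.isRefl x t (hx t)) hx0).ne' (hx x)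

end IsPseudoEuclidean

theorem exists_smul_apply_self_eq_neg_one {t : V} (ht : B t t < 0) :
    ∃ c : ℝ, c ≠ 0 ∧ B (c • t) (c • t) = -1 := by
  have hsqrt : 0 < √(-B t t) := Real.sqrt_pos.2 (neg_pos.2 ht)
  have hsq : √(-B t t) ^ 2 = -B t t := Real.sq_sqrt (neg_pos.2 ht).le
  refine ⟨(√(-B t t))⁻¹, (inv_pos.2 hsqrt).ne', ?_⟩
  simp only [map_smul, LinearMap.smul_apply, smul_eq_mul]
  field_simp
  linarith

theorem mem_orthogonal_span_singleton {t x : V} : x ∈ B.orthogonal (ℝ ∙ t) ↔ B t x = 0 := by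
  rw [LinearMap.BilinForm.orthogonal_span_singleton_eq_toLin_ker]
  exact LinearMap.mem_ker

theorem isPseudoEuclidean_of_timelike [FiniteDimensional ℝ V] (hs : B.IsSymm) {t : V}
    (ht : B t t < 0) (hpos : ∀ x, B t x = 0 → x ≠ 0 → 0 < B x x) : IsPseudoEuclidean B := by
  obtain ⟨c, hc, hu⟩ := exists_smul_apply_self_eq_neg_one ht
  set u := c • t
  have hpos' : ∀ x, B u x = 0 → x ≠ 0 → 0 < B x x := fun x hx =>
    hpos x (by simpa [u, hc] using hx)
  obtain ⟨a, ha⟩ := exists_orthonormal_basis (hs.restrict (B.orthogonal (ℝ ∙ u)))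
    (fun x hx => hpos' x (mem_orthogonal_span_singleton.1 x.2) (by simpa using hx)) rfl
  have hua : ∀ i, B u (a i) = 0 := fun i => mem_orthogonal_span_singleton.1 (a i).2
  let b := Module.Basis.mkFinSnoc a u
    (fun d x hx hd => by
      simpa [hu, mem_orthogonal_span_singleton.1 hx] using congrArg (B u) hd)
    (fun z => ⟨B u z, mem_orthogonal_span_singleton.2 (by simp [hu])⟩)
  refine ⟨_, b, fun i j => ?_⟩
  cases i using Fin.lastCases <;> cases j using Fin.lastCases
  · simp [b, hu]
  · simp [b, hua, (Fin.castSucc_lt_last _).ne']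
  · simp [b, hs.eq _ u, hua, (Fin.castSucc_lt_last _).ne]
  · simpa [b, (Fin.castSucc_lt_last _).ne] using ha _ _

variable {X Y : Submodule ℝ V}

theorem PseudoEuclideanOn.exists_timelike (hX : PseudoEuclideanOn B X) : ∃ t ∈ X, B t t < 0 := by
  obtain ⟨t, ht, -⟩ := hX.exists_timelike_orthogonal_pos
  exact ⟨t, t.2, ht⟩

theorem IsPseudoEuclidean.pseudoEuclideanOn_iff [FiniteDimensional ℝ V]
    (hB : IsPseudoEuclidean B) : PseudoEuclideanOn B X ↔ ∃ t ∈ X, B t t < 0 := by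
  refine ⟨PseudoEuclideanOn.exists_timelike, fun ⟨t, htX, ht⟩ => ?_⟩
  exact isPseudoEuclidean_of_timelike (hB.isSymm.restrict X) (t := ⟨t, htX⟩) ht
    fun x hx hx0 => hB.pos_of_orthogonal_timelike ht hx (by simpa using hx0)

theorem EuclideanOn.nonneg (hX : EuclideanOn B X) {x : V} (hx : x ∈ X) : 0 ≤ B x x := by
  rcases eq_or_ne x 0 with rfl | hx0
  · simp
  · exact (hX x hx hx0).le

theorem EuclideanOn.disjoint_orthogonal (hX : EuclideanOn B X) : Disjoint X (B.orthogonal X) :=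
  Submodule.disjoint_def.2 fun x hx hx' => by
    by_contra hx0
    exact (hX x hx hx0).ne' (hx' x hx)

theorem EuclideanOn.sup (hs : B.IsSymm) (hX : EuclideanOn B X) (hY : EuclideanOn B Y)
    (hXY : Y ≤ B.orthogonal X) : EuclideanOn B (X ⊔ Y) := by
  intro z hz hz0
  obtain ⟨x, hx, y, hy, rfl⟩ := Submodule.mem_sup.1 hz
  have hxy : B x y = 0 := hXY hy x hx
  have hsum : B (x + y) (x + y) = B x x + B y y := by simp [hxy, hs.eq y x]
  rw [hsum]
  rcases eq_or_ne x 0 with rfl | hx0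
  · simpa using hY y hy (by simpa using hz0)
  · linarith [hX x hx hx0, hY.nonneg hy]

theorem EuclideanOn.not_pseudoEuclideanOn (hX : EuclideanOn B X) : ¬ PseudoEuclideanOn B X :=
  fun h => by
    obtain ⟨t, ht, htt⟩ := h.exists_timelike
    exact (hX.nonneg ht).not_gt htt

theorem not_isotropicOn_of_disjoint (h : Disjoint X (B.orthogonal X)) : ¬ IsotropicOn B X := by
  rw [IsotropicOn, h.eq_bot, finrank_bot]
  exact zero_ne_one

theorem IsotropicOn.exists_radical (hX : IsotropicOn B X) :
    ∃ r ∈ X, r ∈ B.orthogonal X ∧ r ≠ 0 := by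
  obtain ⟨r, hr, hr0⟩ := Submodule.exists_mem_ne_zero_of_ne_bot
    (p := X ⊓ B.orthogonal X) fun h => not_isotropicOn_of_disjoint (disjoint_iff.2 h) hX
  exact ⟨r, hr.1, hr.2, hr0⟩

namespace IsPseudoEuclidean

theorem isotropicOn_iff (hB : IsPseudoEuclidean B) :
    IsotropicOn B X ↔ ∃ r ∈ X, r ∈ B.orthogonal X ∧ r ≠ 0 := by
  refine ⟨IsotropicOn.exists_radical, fun ⟨r, hr, hrX, hr0⟩ => ?_⟩
  refine finrank_eq_one (⟨r, hr, hrX⟩ : ↥(X ⊓ B.orthogonal X))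
    (fun h => hr0 (congrArg Subtype.val h)) fun y => ?_
  obtain ⟨c, hc⟩ := hB.exists_smul_eq_of_nonpos (hrX r hr).le (y.2.2 y y.2.1).le (y.2.2 r hr) hr0
  exact ⟨c, Subtype.ext hc⟩

theorem euclideanOn_orthogonal (hB : IsPseudoEuclidean B) (hX : PseudoEuclideanOn B X) :
    EuclideanOn B (B.orthogonal X) := by
  obtain ⟨t, ht, htt⟩ := hX.exists_timelike
  exact fun x hx hx0 => hB.pos_of_orthogonal_timelike htt (hx t ht) hx0

theorem disjoint_orthogonal (hB : IsPseudoEuclidean B) (hX : PseudoEuclideanOn B X) :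
    Disjoint X (B.orthogonal X) :=
  Submodule.disjoint_def.2 fun x hx hx' => by_contra fun hx0 =>
    (hB.euclideanOn_orthogonal hX x hx' hx0).ne' (hx' x hx)

variable [FiniteDimensional ℝ V]

theorem euclideanOn_or_isotropicOn_or_pseudoEuclideanOn (hB : IsPseudoEuclidean B)
    (X : Submodule ℝ V) : EuclideanOn B X ∨ IsotropicOn B X ∨ PseudoEuclideanOn B X := by
  by_cases htime : ∃ t ∈ X, B t t < 0
  · exact .inr (.inr (hB.pseudoEuclideanOn_iff.2 htime))
  push Not at htime
  by_cases hnull : ∃ r ∈ X, r ≠ 0 ∧ B r r = 0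
  · obtain ⟨r, hr, hr0, hrr⟩ := hnull
    have hrad : ∀ x ∈ X, B x r = 0 := fun x hx => by
      simpa [hrr] using (B.restrict X).apply_sq_le_of_symm (fun y => htime y y.2)
        (LinearMap.BilinForm.isSymm_iff.1 (hB.isSymm.restrict X)) ⟨x, hx⟩ ⟨r, hr⟩
    exact .inr (.inl (hB.isotropicOn_iff.2 ⟨r, hr, hrad, hr0⟩))
  · push Not at hnull
    exact .inl fun x hx hx0 => (htime x hx).lt_of_ne' (hnull x hx hx0)

theorem euclideanOn_orthogonal_iff (hB : IsPseudoEuclidean B) :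
    EuclideanOn B (B.orthogonal X) ↔ PseudoEuclideanOn B X := by
  refine ⟨fun h => ?_, hB.euclideanOn_orthogonal⟩
  obtain hX | hX | hX := hB.euclideanOn_or_isotropicOn_or_pseudoEuclideanOn X
  · have htop : EuclideanOn B ⊤ := by
      rw [← ((LinearMap.BilinForm.isCompl_orthogonal_iff_disjoint hB.isRefl).2
        hX.disjoint_orthogonal).sup_eq_top]
      exact hX.sup hB.isSymm h le_rfl
    obtain ⟨t, ht, -⟩ := hB.exists_timelike_orthogonal_pos
    exact absurd ht (htop.nonneg trivial).not_gt
  · obtain ⟨r, hr, hrX, hr0⟩ := hX.exists_radical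
    exact absurd (hrX r hr) (h r hrX hr0).ne'
  · exact hX

theorem orthogonal_orthogonal (hB : IsPseudoEuclidean B) (X : Submodule ℝ V) :
    B.orthogonal (B.orthogonal X) = X :=
  LinearMap.BilinForm.orthogonal_orthogonal hB.nondegenerate hB.isRefl X

theorem pseudoEuclideanOn_orthogonal_iff (hB : IsPseudoEuclidean B) :
    PseudoEuclideanOn B (B.orthogonal X) ↔ EuclideanOn B X := by
  rw [← hB.euclideanOn_orthogonal_iff, hB.orthogonal_orthogonal]

end IsPseudoEuclidean

end IndexOne

/-! ### Witt's extension theorem -/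

section Reflection

variable {K V : Type*} [Field K] [AddCommGroup V] [Module K V] {B : LinearMap.BilinForm K V}

/-- The orthogonal reflection in the hyperplane orthogonal to a non-null vector, as an isometry. -/
def reflection (hs : B.IsSymm) {u : V} (hu : B u u ≠ 0) : B.IsometryEquiv B where
  toLinearEquiv := Module.reflection (x := u) (f := (2 / B u u) • B u) (div_mul_cancel₀ _ hu)
  map_app' x y := by
    change B (Module.reflection _ x) (Module.reflection _ y) = B x y
    simp only [Module.reflection_apply, map_sub, map_smul, LinearMap.sub_apply,
      LinearMap.smul_apply, smul_eq_mul, hs.eq x u]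
    field_simp
    ring

theorem reflection_apply (hs : B.IsSymm) {u : V} (hu : B u u ≠ 0) (x : V) :
    reflection hs hu x = x - (2 / B u u * B u x) • u :=
  Module.reflection_apply x (div_mul_cancel₀ _ hu)

theorem reflection_apply_of_orthogonal (hs : B.IsSymm) {u : V} (hu : B u u ≠ 0) {x : V}
    (hx : B x u = 0) : reflection hs hu x = x := by
  simp [reflection_apply, hs.eq u x, hx]

theorem reflection_sub_apply_left (hs : B.IsSymm) {z w : V} (hzw : B z z = B w w)
    (hu : B (z - w) (z - w) ≠ 0) : reflection hs hu z = w := by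
  have h : 2 * B (z - w) z = B (z - w) (z - w) := by
    simp only [map_sub, LinearMap.sub_apply, hs.eq z w]
    linear_combination hzw
  rw [reflection_apply, div_mul_eq_mul_div, h, div_self hu, one_smul, sub_sub_cancel]

theorem exists_isometryEquiv_of_sub_not_null (hs : B.IsSymm) {X : Submodule K V} {z w : V}
    (hX : ∀ y ∈ X, B y z = B y w) (hzw : B z z = B w w) (hu : B (z - w) (z - w) ≠ 0) :
    ∃ R : B.IsometryEquiv B, (∀ y ∈ X, R y = y) ∧ R z = w :=
  ⟨reflection hs hu, fun y hy => reflection_apply_of_orthogonal hs hu (by simp [hX y hy]),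
    reflection_sub_apply_left hs hzw hu⟩

/- The vectors are moved one at a time, each time keeping the span of those already in place. -/
theorem exists_isometryEquiv_of_forall_exists {ι : Type*} [Finite ι] {x y : ι → V}
    (hxy : ∀ i j, B (x i) (x j) = B (y i) (y j))
    (hstep : ∀ (s : Set ι) (i : ι) (R : B.IsometryEquiv B), i ∉ s → (∀ j ∈ s, R (x j) = y j) →
      (∀ v ∈ Submodule.span K (y '' s), B v (R (x i)) = B v (y i)) →
      ∃ R' : B.IsometryEquiv B, (∀ v ∈ Submodule.span K (y '' s), R' v = v) ∧
        R' (R (x i)) = y i) :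
    ∃ R : B.IsometryEquiv B, ∀ i, R (x i) = y i := by
  suffices h : ∀ s : Set ι, ∃ R : B.IsometryEquiv B, ∀ i ∈ s, R (x i) = y i by
    obtain ⟨R, hR⟩ := h Set.univ
    exact ⟨R, fun i => hR i (Set.mem_univ i)⟩
  intro s
  induction s, s.toFinite using Set.Finite.induction_on with
  | empty => exact ⟨.refl B, by simp⟩
  | @insert i s hi _ ih =>
    obtain ⟨R, hR⟩ := ih
    have heq : Submodule.span K (y '' s) ≤ LinearMap.ker (B.flip (R (x i)) - B.flip (y i)) :=
      Submodule.span_le.2 <| by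
        rintro _ ⟨j, hj, rfl⟩
        simp [← hR j hj, hxy]
    obtain ⟨R', hR', hRi⟩ := hstep s i R hi hR fun v hv => sub_eq_zero.1 (heq hv)
    refine ⟨R.trans R', ?_⟩
    rintro j (rfl | hj)
    · exact hRi
    · exact (congrArg R' (hR j hj)).trans (hR' _ (Submodule.subset_span ⟨j, hj, rfl⟩))

end Reflection

section PositiveDefinite

variable {E F : Type*} [AddCommGroup E] [Module ℝ E] [FiniteDimensional ℝ E]
  [AddCommGroup F] [Module ℝ F] [FiniteDimensional ℝ F]
  {B : LinearMap.BilinForm ℝ E} {C : LinearMap.BilinForm ℝ F}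

theorem equivalent_of_finrank_eq (hBs : B.IsSymm) (hB : ∀ x, x ≠ 0 → 0 < B x x)
    (hCs : C.IsSymm) (hC : ∀ x, x ≠ 0 → 0 < C x x)
    (hEF : Module.finrank ℝ E = Module.finrank ℝ F) : B.Equivalent C := by
  obtain ⟨a, ha⟩ := exists_orthonormal_basis hBs hB hEF
  obtain ⟨c, hc⟩ := exists_orthonormal_basis hCs hC rfl
  have h : C.comp (a.equiv c (.refl _)).toLinearMap (a.equiv c (.refl _)).toLinearMap = B :=
    a.ext fun i => a.ext fun j => by simp [ha, hc]
  exact ⟨{ a.equiv c (.refl _) with map_app' := fun x y => LinearMap.congr_fun₂ h x y }⟩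

theorem exists_isometryEquiv_of_gram_eq (hBs : B.IsSymm) (hB : ∀ x, x ≠ 0 → 0 < B x x)
    (hCs : C.IsSymm) (hC : ∀ x, x ≠ 0 → 0 < C x x)
    (hEF : Module.finrank ℝ E = Module.finrank ℝ F) {ι : Type*} [Finite ι] {x : ι → E}
    {y : ι → F} (hxy : ∀ i j, B (x i) (x j) = C (y i) (y j)) :
    ∃ g : B.IsometryEquiv C, ∀ i, g (x i) = y i := by
  obtain ⟨e⟩ := equivalent_of_finrank_eq hBs hB hCs hC hEF
  obtain ⟨R, hR⟩ := exists_isometryEquiv_of_forall_exists (B := C) (x := fun i => e (x i)) (y := y)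
    (by simpa using hxy) fun s i R _ _ hs => by
      rcases eq_or_ne (R (e (x i))) (y i) with h | h
      · exact ⟨.refl C, fun _ _ => rfl, h⟩
      · exact exists_isometryEquiv_of_sub_not_null hCs hs (by simp [hxy])
          (hC _ (sub_ne_zero.2 h)).ne'
  exact ⟨e.trans R, hR⟩

end PositiveDefinite

section Witt

variable {V : Type*} [AddCommGroup V] [Module ℝ V] [FiniteDimensional ℝ V]
  {B : LinearMap.BilinForm ℝ V} {X : Submodule ℝ V} {z w : V}

namespace IsPseudoEuclidean

theorem exists_mem_orthogonal_apply_ne_zero (hB : IsPseudoEuclidean B) (hz : z ∉ X) :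
    ∃ v ∈ B.orthogonal X, B v z ≠ 0 := by
  by_contra! h
  rw [← hB.orthogonal_orthogonal X] at hz
  exact hz h

theorem exists_mem_orthogonal_apply_ne_zero₂ (hB : IsPseudoEuclidean B) (hz : z ∉ X)
    (hw : w ∉ X) : ∃ v ∈ B.orthogonal X, B v z ≠ 0 ∧ B v w ≠ 0 := by
  obtain ⟨v₁, h₁, h₁z⟩ := hB.exists_mem_orthogonal_apply_ne_zero hz
  obtain ⟨v₂, h₂, h₂w⟩ := hB.exists_mem_orthogonal_apply_ne_zero hw
  by_cases h₁w : B v₁ w = 0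
  · by_cases h₂z : B v₂ z = 0
    · exact ⟨v₁ + v₂, Submodule.add_mem _ h₁ h₂, by simpa [h₂z], by simpa [h₁w]⟩
    · exact ⟨v₂, h₂, h₂z, h₂w⟩
  · exact ⟨v₁, h₁, h₁z, h₁w⟩

/- If `v` and `v + (z - w)` were both null, then `v` would be a multiple of the null vector `z - w`,
which is orthogonal to `z`. -/
theorem exists_mem_orthogonal_not_null (hB : IsPseudoEuclidean B) (hz : z ∉ X) (hw : w ∉ X)
    (hX : z - w ∈ B.orthogonal X) (hne : z - w ≠ 0) (huz : B (z - w) z = 0)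
    (huw : B (z - w) w = 0) : ∃ v ∈ B.orthogonal X, B v z ≠ 0 ∧ B v w ≠ 0 ∧ B v v ≠ 0 := by
  obtain ⟨v, hvX, hvz, hvw⟩ := hB.exists_mem_orthogonal_apply_ne_zero₂ hz hw
  by_cases hv : B v v = 0
  · refine ⟨v + (z - w), Submodule.add_mem _ hvX hX, ?_, ?_, fun h => ?_⟩
    · rwa [map_add, LinearMap.add_apply, huz, add_zero]
    · rwa [map_add, LinearMap.add_apply, huw, add_zero]
    · have hu : B (z - w) (z - w) = 0 := by rw [map_sub, huz, huw, sub_zero]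
      have huv : B (z - w) v = 0 := by
        simp only [map_add, LinearMap.add_apply, hv, hu, hB.isSymm.eq v (z - w)] at h
        linarith
      obtain ⟨c, rfl⟩ := hB.exists_smul_eq_of_nonpos hu.le hv.le huv hne
      exact hvz (by rw [map_smul, LinearMap.smul_apply, huz, smul_zero])
  · exact ⟨v, hvX, hvz, hvw, hv⟩

/- When `z - w` is null, `z` is first reflected in a vector `v` such that the image of `z` differs
from `w` by a non-null vector. -/
theorem exists_isometryEquiv_map_eq (hB : IsPseudoEuclidean B) (hz : z ∉ X) (hw : w ∉ X)
    (hX : ∀ y ∈ X, B y z = B y w) (hzw : B z z = B w w) :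
    ∃ R : B.IsometryEquiv B, (∀ y ∈ X, R y = y) ∧ R z = w := by
  have hs := hB.isSymm
  by_cases hne : z - w = 0
  · exact ⟨.refl B, fun _ _ => rfl, sub_eq_zero.1 hne⟩
  by_cases hu : B (z - w) (z - w) = 0
  swap
  · exact exists_isometryEquiv_of_sub_not_null hs hX hzw hu
  have huz : B (z - w) z = 0 := by
    simp only [map_sub, LinearMap.sub_apply, hs.eq z w] at hu ⊢
    linarith
  have huw : B (z - w) w = 0 := by rwa [map_sub, huz, zero_sub, neg_eq_zero] at hu
  obtain ⟨v, hvX, hvz, hvw, hv⟩ := hB.exists_mem_orthogonal_not_null hz hw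
    (fun y hy => by simp [hX y hy]) hne huz huw
  set R := reflection hs hv
  have hRX : ∀ y ∈ X, R y = y := fun y hy => reflection_apply_of_orthogonal hs hv (hvX y hy)
  have hRz : B (R z - w) (R z - w) = 4 * (B v z * B v w) / B v v := by
    have hRzw : R z - w = (z - w) - (2 / B v v * B v z) • v := by
      rw [reflection_apply]
      abel
    have hsub : B v z - B v w = B v (z - w) := (map_sub _ _ _).symm
    have hexp : B (R z - w) (R z - w) =
        B (z - w) (z - w) - 4 * (B v z * B v (z - w)) / B v v + 4 * B v z ^ 2 / B v v := by
      rw [hRzw]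
      generalize z - w = u
      simp only [map_sub, map_smul, LinearMap.sub_apply, LinearMap.smul_apply, smul_eq_mul,
        hs.eq u v]
      field_simp
      ring
    rw [hexp, hu, ← hsub]
    ring
  obtain ⟨R', hR', hR'z⟩ := exists_isometryEquiv_of_sub_not_null (X := X) (z := R z) hs
    (fun y hy => by rw [← hX y hy, ← R.map_app z y, hRX y hy]) (by rw [R.map_app, hzw])
    (by rw [hRz]; positivity)
  exact ⟨R.trans R', fun y hy => (congrArg R' (hRX y hy)).trans (hR' y hy), hR'z⟩

theorem exists_isometryEquiv_extending (hB : IsPseudoEuclidean B) {ι : Type*} [Finite ι]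
    {x y : ι → V} (hx : LinearIndependent ℝ x) (hy : LinearIndependent ℝ y)
    (hxy : ∀ i j, B (x i) (x j) = B (y i) (y j)) :
    ∃ R : B.IsometryEquiv B, ∀ i, R (x i) = y i := by
  refine exists_isometryEquiv_of_forall_exists hxy fun s i R hi hR hs =>
    hB.exists_isometryEquiv_map_eq ?_ (hy.notMem_span_image hi) hs (by rw [R.map_app, hxy])
  have hRx : LinearIndependent ℝ (R ∘ x) :=
    hx.map' (R : V ≃ₗ[ℝ] V).toLinearMap (R : V ≃ₗ[ℝ] V).ker
  rw [← Set.image_congr hR]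
  exact hRx.notMem_span_image hi

end IsPseudoEuclidean

end Witt

/-! ### The light cone -/

theorem orthogonal_sup {R M : Type*} [CommSemiring R] [AddCommMonoid M] [Module R M]
    (B : LinearMap.BilinForm R M) (X Y : Submodule R M) :
    B.orthogonal (X ⊔ Y) = B.orthogonal X ⊓ B.orthogonal Y := by
  refine le_antisymm (le_inf (B.orthogonal_le le_sup_left) (B.orthogonal_le le_sup_right)) ?_
  rintro v ⟨hX, hY⟩ w hw
  obtain ⟨x, hx, y, hy, rfl⟩ := Submodule.mem_sup.1 hw
  change B (x + y) v = 0
  rw [map_add, LinearMap.add_apply, hX x hx, hY y hy, add_zero]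

section NullVectors

variable {K V : Type*} [Field K] [NeZero (2 : K)] [AddCommGroup V] [Module K V]
  {B : LinearMap.BilinForm K V}

theorem exists_null_add_smul (hs : B.IsSymm) {x v : V} (hx : B x x = 0) (hxv : B x v ≠ 0) :
    ∃ c : K, B (v + c • x) (v + c • x) = 0 := by
  have h2 : (2 : K) ≠ 0 := NeZero.ne 2
  refine ⟨-B v v / (2 * B x v), ?_⟩
  simp only [map_add, map_smul, LinearMap.add_apply, LinearMap.smul_apply, smul_eq_mul, hx,
    hs.eq v x]
  field_simp
  ring

theorem le_of_forall_null_mem_of_apply_ne_zero (hs : B.IsSymm) {X Y : Submodule K V} {x t : V}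
    (hx : x ∈ X) (hxx : B x x = 0) (ht : t ∈ X) (hxt : B x t ≠ 0)
    (h : ∀ v ∈ X, B v v = 0 → v ∈ Y) : X ≤ Y := by
  have hY : ∀ v ∈ X, B x v ≠ 0 → v ∈ Y := fun v hv hxv => by
    obtain ⟨c, hc⟩ := exists_null_add_smul hs hxx hxv
    exact (Y.add_mem_iff_left (Y.smul_mem c (h x hx hxx))).1
      (h _ (X.add_mem hv (X.smul_mem c hx)) hc)
  intro v hv
  by_cases hxv : B x v = 0
  · exact (Y.add_mem_iff_left (hY t ht hxt)).1
      (hY _ (X.add_mem hv ht) (by rwa [map_add, hxv, zero_add]))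
  · exact hY v hv hxv

end NullVectors

namespace IsPseudoEuclidean

variable {V : Type*} [AddCommGroup V] [Module ℝ V] {B : LinearMap.BilinForm ℝ V}

theorem exists_null_smul_add (hB : IsPseudoEuclidean B) {t s : V} (ht : B t t < 0)
    (hts : B t s = 0) (hs : s ≠ 0) :
    ∃ r : ℝ, r ≠ 0 ∧ B (r • t + s) (r • t + s) = 0 ∧ B (r • t - s) (r • t - s) = 0 := by
  have hss := hB.pos_of_orthogonal_timelike ht hts hs
  have hpos : 0 < -B s s / B t t := div_pos_of_neg_of_neg (neg_lt_zero.2 hss) ht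
  have hr : √(-B s s / B t t) ^ 2 * B t t = -B s s := by
    rw [Real.sq_sqrt hpos.le, div_mul_cancel₀ _ ht.ne]
  refine ⟨√(-B s s / B t t), (Real.sqrt_pos.2 hpos).ne', ?_, ?_⟩ <;>
  · simp only [map_add, map_sub, map_smul, LinearMap.add_apply, LinearMap.sub_apply,
      LinearMap.smul_apply, smul_eq_mul, hts, hB.isSymm.eq s t]
    linear_combination hr

theorem exists_null_apply_ne_zero (hB : IsPseudoEuclidean B) {X : Submodule ℝ V}
    (hX : PseudoEuclideanOn B X) (hX₂ : 2 ≤ Module.finrank ℝ X) :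
    ∃ x ∈ X, ∃ t ∈ X, B x x = 0 ∧ B x t ≠ 0 := by
  obtain ⟨t, htX, ht⟩ := hX.exists_timelike
  have : FiniteDimensional ℝ X := Module.finite_of_finrank_pos (by omega)
  obtain ⟨s, hs, hs0⟩ := Submodule.exists_mem_ne_zero_of_ne_bot
    (LinearMap.ker_ne_bot_of_finrank_lt (f := (B t).domRestrict X)
      (by rw [Module.finrank_self]; omega))
  have hts : B t s = 0 := hs
  obtain ⟨r, hr, hnull, -⟩ := hB.exists_null_smul_add ht hts (by simpa using hs0)
  refine ⟨r • t + s, X.add_mem (X.smul_mem r htX) s.2, t, htX, hnull, ?_⟩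
  simpa [hB.isSymm.eq s t, hts] using ⟨hr, ht.ne⟩

theorem le_of_forall_null_mem (hB : IsPseudoEuclidean B) {X Y : Submodule ℝ V}
    (hX : PseudoEuclideanOn B X) (hX₂ : 2 ≤ Module.finrank ℝ X)
    (h : ∀ v ∈ X, B v v = 0 → v ∈ Y) : X ≤ Y := by
  obtain ⟨x, hx, t, ht, hxx, hxt⟩ := hB.exists_null_apply_ne_zero hX hX₂
  exact le_of_forall_null_mem_of_apply_ne_zero hB.isSymm hx hxx ht hxt h

/- Subtracting a multiple of `B`, we may assume that `C` vanishes at a timelike vector `t`. The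
vectors `r • t ± s` with `s` orthogonal to `t` exhaust the light cone. -/
theorem exists_eq_smul_of_null (hB : IsPseudoEuclidean B) {C : LinearMap.BilinForm ℝ V}
    (hC : C.IsSymm) (hnull : ∀ x, B x x = 0 → C x x = 0) : ∃ c : ℝ, C = c • B := by
  obtain ⟨t, ht, -⟩ := hB.exists_timelike_orthogonal_pos
  set D := C - (C t t / B t t) • B with hD
  have hDapp : ∀ x y, D x y = C x y - C t t / B t t * B x y := fun x y => by simp [hD]
  have hDs : D.IsSymm := ⟨fun x y => by simp [hDapp, hC.eq x y, hB.isSymm.eq x y]⟩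
  have hDnull : ∀ x, B x x = 0 → D x x = 0 := fun x hx => by simp [hDapp, hnull x hx, hx]
  have hDt : D t t = 0 := by rw [hDapp, div_mul_cancel₀ _ ht.ne, sub_self]
  have hDperp : ∀ s, B t s = 0 → D t s = 0 ∧ D s s = 0 := fun s hts => by
    rcases eq_or_ne s 0 with rfl | hs
    · simp
    obtain ⟨r, hr, h₁, h₂⟩ := hB.exists_null_smul_add ht hts hs
    replace h₁ := hDnull _ h₁
    replace h₂ := hDnull _ h₂
    simp only [map_add, map_sub, map_smul, LinearMap.add_apply, LinearMap.sub_apply,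
      LinearMap.smul_apply, smul_eq_mul, hDt, hDs.eq s t] at h₁ h₂
    exact ⟨(mul_eq_zero.1 (by linarith : r * D t s = 0)).resolve_left hr, by linarith⟩
  refine ⟨C t t / B t t, sub_eq_zero.1 (LinearMap.BilinForm.ext_of_isSymm hDs
    LinearMap.BilinForm.isSymm_zero fun x => ?_)⟩
  have hts : B t (x - (B t x / B t t) • t) = 0 := by
    rw [map_sub, map_smul, smul_eq_mul, div_mul_cancel₀ _ ht.ne, sub_self]
  obtain ⟨h₁, h₂⟩ := hDperp _ hts
  simp only [map_sub, map_smul, LinearMap.sub_apply, LinearMap.smul_apply, smul_eq_mul, hDt,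
    hDs.eq x t] at h₁ h₂
  change D x x = 0
  linear_combination h₂ + 2 * (B t x / B t t) * h₁

/- Otherwise `B t y • x - B t x • y` would be a timelike vector orthogonal to `t`. -/
theorem mul_apply_nonneg_of_null (hB : IsPseudoEuclidean B) {t x y : V} (ht : B t t < 0)
    (hx : B x x = 0) (hy : B y y = 0) (hxy : B x y < 0) : 0 ≤ B t x * B t y := by
  by_contra! h
  have hw : B t (B t y • x - B t x • y) = 0 := by
    rw [map_sub, map_smul, map_smul, smul_eq_mul, smul_eq_mul, mul_comm, sub_self]
  have hww : B (B t y • x - B t x • y) (B t y • x - B t x • y) < 0 := by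
    simp only [map_sub, map_smul, LinearMap.sub_apply, LinearMap.smul_apply, smul_eq_mul, hx, hy,
      hB.isSymm.eq y x]
    nlinarith [mul_pos_of_neg_of_neg h hxy]
  refine hww.not_gt (hB.pos_of_orthogonal_timelike ht hw fun h0 => ?_)
  simp [h0] at hww

theorem orthogonal_inf [FiniteDimensional ℝ V] (hB : IsPseudoEuclidean B) (X Y : Submodule ℝ V) :
    B.orthogonal (X ⊓ Y) = B.orthogonal X ⊔ B.orthogonal Y := by
  have h := orthogonal_sup B (B.orthogonal X) (B.orthogonal Y)
  rw [hB.orthogonal_orthogonal, hB.orthogonal_orthogonal] at h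
  rw [← h, hB.orthogonal_orthogonal]

end IsPseudoEuclidean

section QuadricSection

variable {V : Type*} [AddCommGroup V] [Module ℝ V] {B : LinearMap.BilinForm ℝ V}
  {X Y : Submodule ℝ V}

/-- The points of the Möbius space in the projectivization of a subspace. For the space of a
`Subsphere` these are by definition its `points`. -/
def quadricSection (B : LinearMap.BilinForm ℝ V) (X : Submodule ℝ V) : Set (ℙ ℝ V) :=
  {p | p ∈ quadric B ∧ p.submodule ≤ X}

theorem mk_mem_quadric {v : V} (hv : v ≠ 0) :
    Projectivization.mk ℝ v hv ∈ quadric B ↔ B v v = 0 := by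
  simp only [quadric, Set.mem_ofPred_eq, Projectivization.submodule_mk]
  refine ⟨fun h => h v (Submodule.mem_span_singleton_self v), fun h x hx => ?_⟩
  obtain ⟨c, rfl⟩ := Submodule.mem_span_singleton.1 hx
  simp [h]

theorem mk_mem_quadricSection {v : V} (hv : v ≠ 0) :
    Projectivization.mk ℝ v hv ∈ quadricSection B X ↔ B v v = 0 ∧ v ∈ X := by
  simp only [quadricSection, Set.mem_ofPred_eq, mk_mem_quadric, Projectivization.submodule_mk,
    Submodule.span_singleton_le_iff_mem]

theorem quadricSection_inf :
    quadricSection B (X ⊓ Y) = quadricSection B X ∩ quadricSection B Y := by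
  ext p
  simp only [quadricSection, Set.mem_inter_iff, Set.mem_ofPred_eq, le_inf_iff]
  tauto

theorem quadricSection_eq_empty (h : ∀ v ∈ X, B v v = 0 → v = 0) : quadricSection B X = ∅ := by
  refine Set.eq_empty_of_forall_notMem fun p => ?_
  induction p using Projectivization.ind with
  | h v hv =>
    rw [mk_mem_quadricSection]
    exact fun ⟨hvv, hvX⟩ => hv (h v hvX hvv)

theorem EuclideanOn.quadricSection_eq_empty (hX : EuclideanOn B X) : quadricSection B X = ∅ :=
  Moebius.quadricSection_eq_empty fun v hv hvv => by_contra fun hv0 => (hX v hv hv0).ne' hvv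

theorem PseudoEuclideanOn.quadricSection_eq_empty (hX : PseudoEuclideanOn B X)
    (hX₁ : Module.finrank ℝ X = 1) : quadricSection B X = ∅ :=
  Moebius.quadricSection_eq_empty fun v hv hvv => by_contra fun hv0 => by
    obtain ⟨t, ht, htt⟩ := hX.exists_timelike
    obtain ⟨c, hc⟩ := exists_smul_eq_of_finrank_eq_one hX₁
      (x := (⟨v, hv⟩ : X)) (fun h => hv0 (congrArg Subtype.val h)) ⟨t, ht⟩
    rw [← show c • v = t from congrArg Subtype.val hc] at htt
    simp [hvv] at htt

theorem PseudoEuclideanOn.one_le_finrank (hX : PseudoEuclideanOn B X) :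
    1 ≤ Module.finrank ℝ X := by
  obtain ⟨k, b, -⟩ := hX
  rw [Module.finrank_eq_card_basis b, Fintype.card_fin]
  exact Nat.le_add_left 1 k

namespace IsPseudoEuclidean

theorem quadricSection_subset_iff (hB : IsPseudoEuclidean B) (hX : PseudoEuclideanOn B X)
    (hX₂ : 2 ≤ Module.finrank ℝ X) : quadricSection B X ⊆ quadricSection B Y ↔ X ≤ Y := by
  refine ⟨fun h => hB.le_of_forall_null_mem hX hX₂ fun v hv hvv => ?_,
    fun h p hp => ⟨hp.1, hp.2.trans h⟩⟩
  rcases eq_or_ne v 0 with rfl | hv0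
  · exact zero_mem _
  · exact ((mk_mem_quadricSection hv0).1 (h ((mk_mem_quadricSection hv0).2 ⟨hvv, hv⟩))).2

theorem quadricSection_nontrivial (hB : IsPseudoEuclidean B) (hX : PseudoEuclideanOn B X)
    (hX₂ : 2 ≤ Module.finrank ℝ X) : (quadricSection B X).Nontrivial := by
  obtain ⟨x, hx, t, ht, hxx, hxt⟩ := hB.exists_null_apply_ne_zero hX hX₂
  obtain ⟨c, hc⟩ := exists_null_add_smul hB.isSymm hxx hxt
  have hxy : B x (t + c • x) ≠ 0 := by rwa [map_add, map_smul, hxx, smul_zero, add_zero]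
  have hx0 : x ≠ 0 := by rintro rfl; simp at hxt
  have hy0 : t + c • x ≠ 0 := fun h => hxy (by rw [h, map_zero])
  refine ⟨.mk ℝ x hx0, (mk_mem_quadricSection _).2 ⟨hxx, hx⟩, .mk ℝ _ hy0,
    (mk_mem_quadricSection _).2 ⟨hc, X.add_mem ht (X.smul_mem c hx)⟩, fun h => hxy ?_⟩
  obtain ⟨a, ha⟩ := (Projectivization.mk_eq_mk_iff' ℝ _ _ hy0 hx0).1 h.symm
  rw [← ha, map_smul, hxx, smul_zero]

theorem exists_quadricSection_eq_singleton (hB : IsPseudoEuclidean B) (hX : IsotropicOn B X) :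
    ∃ p, quadricSection B X = {p} := by
  obtain ⟨r, hr, hrX, hr0⟩ := hX.exists_radical
  have hrr : B r r = 0 := hrX r hr
  refine ⟨.mk ℝ r hr0, Set.eq_singleton_iff_unique_mem.2
    ⟨(mk_mem_quadricSection hr0).2 ⟨hrr, hr⟩, fun p hp => ?_⟩⟩
  induction p using Projectivization.ind with
  | h v hv =>
    rw [mk_mem_quadricSection] at hp
    obtain ⟨c, hc⟩ := hB.exists_smul_eq_of_nonpos hrr.le hp.1.le
      (hB.isRefl _ _ (hrX v hp.2)) hr0
    exact (Projectivization.mk_eq_mk_iff' ℝ _ _ hv hr0).2 ⟨c, hc⟩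

variable [FiniteDimensional ℝ V]

theorem quadricSection_nontrivial_iff (hB : IsPseudoEuclidean B) :
    (quadricSection B X).Nontrivial ↔ PseudoEuclideanOn B X ∧ 2 ≤ Module.finrank ℝ X := by
  refine ⟨fun h => ?_, fun h => hB.quadricSection_nontrivial h.1 h.2⟩
  obtain hX | hX | hX := hB.euclideanOn_or_isotropicOn_or_pseudoEuclideanOn X
  · exact absurd hX.quadricSection_eq_empty h.nonempty.ne_empty
  · obtain ⟨p, hp⟩ := hB.exists_quadricSection_eq_singleton hX
    exact absurd hp h.ne_singleton
  · refine ⟨hX, hX.one_le_finrank.lt_of_ne' fun hX₁ => ?_⟩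
    exact h.nonempty.ne_empty (hX.quadricSection_eq_empty hX₁)

theorem exists_quadricSection_eq_singleton_iff (hB : IsPseudoEuclidean B) :
    (∃ p, quadricSection B X = {p}) ↔ IsotropicOn B X := by
  refine ⟨fun ⟨p, hp⟩ => ?_, hB.exists_quadricSection_eq_singleton⟩
  have hne : quadricSection B X ≠ ∅ := hp ▸ Set.singleton_ne_empty p
  obtain hX | hX | hX := hB.euclideanOn_or_isotropicOn_or_pseudoEuclideanOn X
  · exact absurd hX.quadricSection_eq_empty hne
  · exact hX
  · obtain hX₁ | hX₂ := hX.one_le_finrank.eq_or_lt'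
    · exact absurd (hX.quadricSection_eq_empty hX₁) hne
    · exact absurd hp (hB.quadricSection_nontrivial hX hX₂).ne_singleton

theorem quadricSection_eq_empty_iff (hB : IsPseudoEuclidean B) :
    quadricSection B X = ∅ ↔
      EuclideanOn B X ∨ PseudoEuclideanOn B X ∧ Module.finrank ℝ X = 1 := by
  refine ⟨fun h => ?_, fun h => h.elim EuclideanOn.quadricSection_eq_empty
    fun h => h.1.quadricSection_eq_empty h.2⟩
  obtain hX | hX | hX := hB.euclideanOn_or_isotropicOn_or_pseudoEuclideanOn X
  · exact .inl hX
  · obtain ⟨p, hp⟩ := hB.exists_quadricSection_eq_singleton hX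
    exact absurd (hp.symm.trans h) (Set.singleton_ne_empty p)
  · refine .inr ⟨hX, hX.one_le_finrank.antisymm' (not_lt.1 fun hX₂ => ?_)⟩
    exact (hB.quadricSection_nontrivial hX hX₂).nonempty.ne_empty h

end IsPseudoEuclidean

end QuadricSection

namespace Subsphere

variable {V : Type*} [AddCommGroup V] [Module ℝ V] {B : LinearMap.BilinForm ℝ V} {m l : ℕ}
  {S : Subsphere B m} {T : Subsphere B l}

theorem two_le_finrank_space (S : Subsphere B m) : 2 ≤ Module.finrank ℝ S.space :=
  S.finrank_eq ▸ Nat.le_add_left 2 m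

theorem points_subset_iff (hB : IsPseudoEuclidean B) : S.points ⊆ T.points ↔ S.space ≤ T.space :=
  hB.quadricSection_subset_iff S.pseudoEuclidean S.two_le_finrank_space

variable [FiniteDimensional ℝ V] {n : ℕ}

theorem finrank_perp (hB : IsPseudoEuclidean B) (S : Subsphere B m)
    (hV : Module.finrank ℝ V = n + 2) : Module.finrank ℝ S.perp = n - m := by
  rw [LinearMap.BilinForm.finrank_orthogonal hB.nondegenerate, S.finrank_eq, hV]
  omega

theorem exists_hypersphere (hB : IsPseudoEuclidean B) (S : Subsphere B m) (hn : 1 ≤ n)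
    (hV : Module.finrank ℝ V = n + 2) {v : V} (hv : v ∈ S.perp) (hv0 : v ≠ 0) :
    ∃ H : Subsphere B (n - 1), H.space = B.orthogonal (ℝ ∙ v) ∧ S.space ≤ H.space := by
  have hle : S.space ≤ B.orthogonal (ℝ ∙ v) := fun x hx =>
    mem_orthogonal_span_singleton.2 (hB.isRefl _ _ (hv x hx))
  obtain ⟨t, ht, htt⟩ := S.pseudoEuclidean.exists_timelike
  refine ⟨⟨B.orthogonal (ℝ ∙ v), hB.pseudoEuclideanOn_iff.2 ⟨t, hle ht, htt⟩, ?_⟩, rfl, hle⟩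
  rw [LinearMap.BilinForm.finrank_orthogonal hB.nondegenerate, finrank_span_singleton hv0, hV]
  omega

namespace GeneralPosition

variable {S₁ : Subsphere B m} {S₂ : Subsphere B l}

theorem disjoint_perp (h : GeneralPosition n S₁ S₂) (hB : IsPseudoEuclidean B) (hn : 1 ≤ n)
    (hV : Module.finrank ℝ V = n + 2) : Disjoint S₁.perp S₂.perp := by
  refine Submodule.disjoint_def.2 fun v hv₁ hv₂ => by_contra fun hv0 => ?_
  obtain ⟨H₁, hH₁, hle₁⟩ := S₁.exists_hypersphere hB hn hV hv₁ hv0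
  obtain ⟨H₂, hH₂, hle₂⟩ := S₂.exists_hypersphere hB hn hV hv₂ hv0
  exact h ⟨H₁, Set.union_subset ((points_subset_iff hB).2 hle₁)
    ((points_subset_iff hB).2 (hle₂.trans_eq (hH₂.trans hH₁.symm)))⟩

theorem finrank_inf (h : GeneralPosition n S₁ S₂) (hB : IsPseudoEuclidean B) (hn : 1 ≤ n)
    (hV : Module.finrank ℝ V = n + 2) :
    Module.finrank ℝ ↥(S₂.space ⊓ S₁.space) + n = m + l + 2 := by
  have hsup : S₂.space ⊔ S₁.space = ⊤ := by
    rw [← hB.orthogonal_orthogonal (S₂.space ⊔ S₁.space), orthogonal_sup,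
      (h.disjoint_perp hB hn hV).symm.eq_bot, LinearMap.BilinForm.orthogonal_bot]
  have hdim := Submodule.finrank_sup_add_finrank_inf_eq S₂.space S₁.space
  rw [hsup, finrank_top, hV, S₁.finrank_eq, S₂.finrank_eq] at hdim
  omega

end GeneralPosition

end Subsphere

/-! ### The operator `A` -/

namespace Subsphere

section Projections

variable {V : Type*} [AddCommGroup V] [Module ℝ V] {B : LinearMap.BilinForm ℝ V} {m l : ℕ}
  (S₁ : Subsphere B m) (S₂ : Subsphere B l)

/-- The projection of `S₁.perp` to `S₂.space` belonging to `V = S₂.perp ⊕ S₂.space`, with values in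
`V`. It complements `proj S₁ S₂`, and its quadratic form is that of `1 - opA S₁ S₂`. -/
noncomputable def coproj : S₁.perp →ₗ[ℝ] V :=
  S₁.perp.subtype - S₂.perp.subtype ∘ₗ proj S₁ S₂

theorem coproj_apply (x : S₁.perp) : coproj S₁ S₂ x = x - proj S₁ S₂ x :=
  rfl

theorem coproj_mem_space (x : S₁.perp) : coproj S₁ S₂ x ∈ S₂.space := by
  rw [← Submodule.projectionOnto_apply_eq_zero_iff S₂.isCompl, coproj_apply, map_sub,
    Submodule.projectionOnto_apply_left]
  exact sub_self _

theorem proj_eq_of_sub_mem {x : S₁.perp} {y : S₂.perp} (h : (x : V) - y ∈ S₂.space) :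
    proj S₁ S₂ x = y := by
  rwa [← Submodule.projectionOnto_apply_eq_zero_iff S₂.isCompl, map_sub,
    Submodule.projectionOnto_apply_left, sub_eq_zero] at h

theorem apply_proj (x : S₁.perp) (y : S₂.perp) : B (proj S₁ S₂ x) y = B (x : V) y := by
  have h : B (coproj S₁ S₂ x) y = 0 := y.2 _ (coproj_mem_space S₁ S₂ x)
  rw [coproj_apply, map_sub, LinearMap.sub_apply] at h
  exact (sub_eq_zero.1 h).symm

theorem coproj_mem_orthogonal_inf (x : S₁.perp) :
    coproj S₁ S₂ x ∈ B.orthogonal (S₂.space ⊓ S₁.space) :=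
  sub_mem (B.orthogonal_le inf_le_right x.2) (B.orthogonal_le inf_le_left (proj S₁ S₂ x).2)

theorem perp_sup_range_coproj : S₂.perp ⊔ (coproj S₁ S₂).range = S₂.perp ⊔ S₁.perp := by
  refine le_antisymm (sup_le le_sup_left ?_) (sup_le le_sup_left fun x hx => ?_)
  · rintro _ ⟨x, rfl⟩
    exact sub_mem (Submodule.mem_sup_right x.2) (Submodule.mem_sup_left (proj S₁ S₂ x).2)
  · exact Submodule.mem_sup.2 ⟨proj S₁ S₂ ⟨x, hx⟩, (proj S₁ S₂ ⟨x, hx⟩).2,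
      coproj S₁ S₂ ⟨x, hx⟩, ⟨_, rfl⟩, add_sub_cancel _ _⟩

variable {S₁ S₂}

theorem coproj_ne_zero (h : Disjoint S₁.perp S₂.perp) {x : S₁.perp} (hx : x ≠ 0) :
    coproj S₁ S₂ x ≠ 0 := fun h0 => by
  have hproj : (x : V) = proj S₁ S₂ x := sub_eq_zero.1 h0
  exact hx (Subtype.ext (Submodule.disjoint_def.1 h x x.2 (hproj ▸ (proj S₁ S₂ x).2)))

theorem coproj_mem_space_inf_of_opA_eq_self {x : S₁.perp} (hx : opA S₁ S₂ x = x) :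
    coproj S₁ S₂ x ∈ S₂.space ⊓ S₁.space := by
  have h : coproj S₂ S₁ (proj S₁ S₂ x) = -coproj S₁ S₂ x := by
    rw [coproj_apply, coproj_apply, neg_sub, ← LinearMap.comp_apply]
    exact congrArg (fun y : S₁.perp => (proj S₁ S₂ x : V) - y) hx
  exact ⟨coproj_mem_space S₁ S₂ x, neg_mem_iff.1 (h ▸ coproj_mem_space S₂ S₁ _)⟩

theorem apply_opA (hs : B.IsSymm) (x y : S₁.perp) :
    B (opA S₁ S₂ x) y = B (proj S₁ S₂ x) (proj S₁ S₂ y) := by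
  rw [hs.eq (proj S₁ S₂ x : V), apply_proj, hs.eq (y : V)]
  exact apply_proj S₂ S₁ (proj S₁ S₂ x) y

theorem apply_opA_eq_apply_opA (hs : B.IsSymm) (x y : S₁.perp) :
    B (opA S₁ S₂ x) y = B x (opA S₁ S₂ y) := by
  rw [apply_opA hs, hs.eq, ← apply_opA hs, hs.eq]

theorem apply_coproj_self (hs : B.IsSymm) (x : S₁.perp) :
    B (coproj S₁ S₂ x) (coproj S₁ S₂ x) = B (x : V) x - B (opA S₁ S₂ x) x := by
  have h := apply_proj S₁ S₂ x (proj S₁ S₂ x)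
  rw [apply_opA hs, coproj_apply]
  simp only [map_sub, LinearMap.sub_apply, hs.eq (proj S₁ S₂ x : V) x]
  linarith

end Projections

section Eigenvalues

variable {V : Type*} [AddCommGroup V] [Module ℝ V] [FiniteDimensional ℝ V]
  {B : LinearMap.BilinForm ℝ V} {m l n : ℕ} {S₁ : Subsphere B m} {S₂ : Subsphere B l}

theorem exists_eigenbasis (hB : IsPseudoEuclidean B) (hV : Module.finrank ℝ V = n + 2)
    (S₁ : Subsphere B m) (S₂ : Subsphere B l) :
    ∃ a : Module.Basis (Fin (n - m)) ℝ S₁.perp,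
      (∀ i j, B (a i) (a j) = if i = j then 1 else 0) ∧
      (∀ i : Fin (n - m), opA S₁ S₂ (a i) = eigenvalue S₁ S₂ i • a i) ∧
      Antitone fun i : Fin (n - m) => eigenvalue S₁ S₂ i := by
  obtain ⟨a, α, hα, ha, haα, hsort⟩ := exists_orthonormal_eigenbasis (hB.isSymm.restrict S₁.perp)
    (fun x hx => hB.euclideanOn_orthogonal S₁.pseudoEuclidean x x.2 (by simpa using hx))
    (apply_opA_eq_apply_opA (S₂ := S₂) hB.isSymm) (S₁.finrank_perp hB hV)
  have heig : ∀ i : Fin (n - m), eigenvalue S₁ S₂ i = α i := fun i => by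
    simp [eigenvalue, hsort]
  simp only [heig]
  exact ⟨a, ha, haα, hα⟩

theorem eigenvalue_nonneg (hB : IsPseudoEuclidean B) (hV : Module.finrank ℝ V = n + 2)
    (i : Fin (n - m)) : 0 ≤ eigenvalue S₁ S₂ i := by
  obtain ⟨a, ha, haα, -⟩ := exists_eigenbasis hB hV S₁ S₂
  have h : eigenvalue S₁ S₂ i = B (proj S₁ S₂ (a i)) (proj S₁ S₂ (a i)) := by
    rw [← apply_opA hB.isSymm, haα]
    simp [ha]
  rw [h]
  exact (hB.euclideanOn_orthogonal S₂.pseudoEuclidean).nonneg (proj S₁ S₂ (a i)).2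

theorem exists_opA_eq_eigenvalue_zero_smul (hB : IsPseudoEuclidean B)
    (hV : Module.finrank ℝ V = n + 2) (hmn : m < n) (S₁ : Subsphere B m) (S₂ : Subsphere B l) :
    ∃ x : S₁.perp, B x x = 1 ∧ opA S₁ S₂ x = eigenvalue S₁ S₂ 0 • x := by
  obtain ⟨a, ha, haα, -⟩ := exists_eigenbasis hB hV S₁ S₂
  exact ⟨a ⟨0, by omega⟩, by simp [ha], haα ⟨0, by omega⟩⟩

theorem euclideanOn_of_one_lt_eigenvalue (hB : IsPseudoEuclidean B)
    (hV : Module.finrank ℝ V = n + 2) (hmn : m < n) (h : 1 < eigenvalue S₁ S₂ 0) :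
    EuclideanOn B (S₂.space ⊓ S₁.space) := by
  obtain ⟨x, hx, hAx⟩ := exists_opA_eq_eigenvalue_zero_smul hB hV hmn S₁ S₂
  refine hB.pseudoEuclideanOn_orthogonal_iff.1 (hB.pseudoEuclideanOn_iff.2
    ⟨coproj S₁ S₂ x, coproj_mem_orthogonal_inf S₁ S₂ x, ?_⟩)
  rw [apply_coproj_self hB.isSymm, hAx]
  simpa [hx] using h

theorem isotropicOn_of_eigenvalue_eq_one (hB : IsPseudoEuclidean B)
    (hV : Module.finrank ℝ V = n + 2) (hmn : m < n) (hS : Disjoint S₁.perp S₂.perp)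
    (h : eigenvalue S₁ S₂ 0 = 1) : IsotropicOn B (S₂.space ⊓ S₁.space) := by
  obtain ⟨x, hx, hAx⟩ := exists_opA_eq_eigenvalue_zero_smul hB hV hmn S₁ S₂
  rw [h, one_smul] at hAx
  exact hB.isotropicOn_iff.2 ⟨coproj S₁ S₂ x, coproj_mem_space_inf_of_opA_eq_self hAx,
    coproj_mem_orthogonal_inf S₁ S₂ x, coproj_ne_zero hS (by rintro rfl; simp at hx)⟩

theorem pseudoEuclideanOn_of_eigenvalue_lt_one (hB : IsPseudoEuclidean B)
    (hV : Module.finrank ℝ V = n + 2) (h : eigenvalue S₁ S₂ 0 < 1) :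
    PseudoEuclideanOn B (S₂.space ⊓ S₁.space) := by
  obtain ⟨a, ha, haα, hanti⟩ := exists_eigenbasis hB hV S₁ S₂
  have hrange : EuclideanOn B (coproj S₁ S₂).range := by
    rintro _ ⟨x, rfl⟩ hx0
    have hlt := apply_lt_of_orthonormal_eigenbasis (B := B.restrict S₁.perp) ha haα
      (fun i => (hanti (Fin.mk_le_of_le_val (Nat.zero_le i))).trans_lt h)
      (x := x) (by rintro rfl; exact hx0 (map_zero _))
    rw [apply_coproj_self hB.isSymm, sub_pos]
    simpa using hlt
  rw [← hB.euclideanOn_orthogonal_iff, hB.orthogonal_inf, ← perp_sup_range_coproj]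
  refine (hB.euclideanOn_orthogonal S₂.pseudoEuclidean).sup hB.isSymm hrange ?_
  rw [hB.orthogonal_orthogonal]
  rintro _ ⟨x, rfl⟩
  exact coproj_mem_space S₁ S₂ x

theorem eigenvalue_lt_one_iff (hB : IsPseudoEuclidean B)
    (hV : Module.finrank ℝ V = n + 2) (hmn : m < n) (hS : Disjoint S₁.perp S₂.perp) :
    eigenvalue S₁ S₂ 0 < 1 ↔ PseudoEuclideanOn B (S₂.space ⊓ S₁.space) := by
  refine ⟨pseudoEuclideanOn_of_eigenvalue_lt_one hB hV, fun h => ?_⟩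
  obtain hlt | heq | hgt := lt_trichotomy (eigenvalue S₁ S₂ 0) 1
  · exact hlt
  · exact absurd (isotropicOn_of_eigenvalue_eq_one hB hV hmn hS heq)
      (not_isotropicOn_of_disjoint (hB.disjoint_orthogonal h))
  · exact absurd h (euclideanOn_of_one_lt_eigenvalue hB hV hmn hgt).not_pseudoEuclideanOn

theorem eigenvalue_eq_one_iff (hB : IsPseudoEuclidean B)
    (hV : Module.finrank ℝ V = n + 2) (hmn : m < n) (hS : Disjoint S₁.perp S₂.perp) :
    eigenvalue S₁ S₂ 0 = 1 ↔ IsotropicOn B (S₂.space ⊓ S₁.space) := by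
  refine ⟨isotropicOn_of_eigenvalue_eq_one hB hV hmn hS, fun h => ?_⟩
  obtain hlt | heq | hgt := lt_trichotomy (eigenvalue S₁ S₂ 0) 1
  · exact absurd h (not_isotropicOn_of_disjoint
      (hB.disjoint_orthogonal (pseudoEuclideanOn_of_eigenvalue_lt_one hB hV hlt)))
  · exact heq
  · exact absurd h (not_isotropicOn_of_disjoint
      (euclideanOn_of_one_lt_eigenvalue hB hV hmn hgt).disjoint_orthogonal)

theorem one_lt_eigenvalue_iff (hB : IsPseudoEuclidean B)
    (hV : Module.finrank ℝ V = n + 2) (hmn : m < n) (hS : Disjoint S₁.perp S₂.perp) :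
    1 < eigenvalue S₁ S₂ 0 ↔ EuclideanOn B (S₂.space ⊓ S₁.space) := by
  refine ⟨euclideanOn_of_one_lt_eigenvalue hB hV hmn, fun h => lt_of_not_ge fun hle => ?_⟩
  obtain hlt | heq := hle.lt_or_eq
  · exact h.not_pseudoEuclideanOn (pseudoEuclideanOn_of_eigenvalue_lt_one hB hV hlt)
  · exact not_isotropicOn_of_disjoint h.disjoint_orthogonal
      (isotropicOn_of_eigenvalue_eq_one hB hV hmn hS heq)

end Eigenvalues

end Subsphere

/-! ### Mutual position -/

namespace Subsphere

section Position

variable {V : Type*} [AddCommGroup V] [Module ℝ V] {B : LinearMap.BilinForm ℝ V} {m l n : ℕ}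

/- For a null vector `x` of `S.space`, the null vector `(2 * B t x / B t t) • t - x` belongs to the
same half of the light cone; a normal vector of `H` takes opposite values at the two. -/
theorem OnOneSide.perp_le_perp {H : Subsphere B m} {S : Subsphere B l} (h : OnOneSide H S)
    (hB : IsPseudoEuclidean B) {t : V} (htS : t ∈ S.space) (htH : t ∈ H.space) (ht : B t t < 0) :
    H.perp ≤ S.perp := by
  intro v hv
  have hvt : B v t = 0 := hB.isRefl _ _ (hv t htH)
  suffices S.space ≤ (B v).ker from fun x hx => hB.isRefl _ _ (this hx)
  refine hB.le_of_forall_null_mem S.pseudoEuclidean S.two_le_finrank_space fun x hx hxx => ?_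
  rcases eq_or_ne x 0 with rfl | hx0
  · exact zero_mem _
  have htx : B t x ≠ 0 := fun htx => (hB.pos_of_orthogonal_timelike ht htx hx0).ne' hxx
  set y := (2 * B t x / B t t) • t - x with hy
  have hyy : B y y = 0 := by
    simp only [hy, map_sub, map_smul, LinearMap.sub_apply, LinearMap.smul_apply, smul_eq_mul, hxx,
      hB.isSymm.eq x t]
    field_simp [ht.ne]
    ring
  have hxy : B x y < 0 := by
    have hxy' : B x y = 2 * (B t x ^ 2 / B t t) := by
      rw [hy, map_sub, map_smul, smul_eq_mul, hxx, hB.isSymm.eq x t]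
      ring
    rw [hxy']
    exact mul_neg_of_pos_of_neg two_pos (div_neg_of_pos_of_neg (by positivity) ht)
  have hside := h v hv x hx y (S.space.sub_mem (S.space.smul_mem _ htS) hx) hxx hyy hxy
  have hvy : B v y = -B v x := by rw [hy, map_sub, map_smul, hvt, smul_zero, zero_sub]
  rw [hvy, mul_neg, Left.nonneg_neg_iff, ← sq] at hside
  exact pow_eq_zero_iff two_ne_zero |>.1 (le_antisymm hside (sq_nonneg _))

theorem points_inter_points (S₁ : Subsphere B m) (S₂ : Subsphere B l) :
    S₁.points ∩ S₂.points = quadricSection B (S₂.space ⊓ S₁.space) := by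
  rw [quadricSection_inf, Set.inter_comm]
  rfl

theorem onOneSide_of_timelike_add {H₁ : Subsphere B m} {H₂ : Subsphere B l}
    (hB : IsPseudoEuclidean B) {v₁ v₂ : V} (hv₁ : H₁.perp ≤ ℝ ∙ v₁) (hv₂ : v₂ ∈ H₂.perp)
    (ht : B (v₂ + v₁) (v₂ + v₁) < 0) : OnOneSide H₁ H₂ := by
  intro v hv x hx y hy hxx hyy hxy
  obtain ⟨c, rfl⟩ := Submodule.mem_span_singleton.1 (hv₁ hv)
  have hv₂x : ∀ x ∈ H₂.space, B (v₂ + v₁) x = B v₁ x := fun x hx => by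
    rw [map_add, LinearMap.add_apply, hB.isRefl _ _ (hv₂ x hx), zero_add]
  have h := hB.mul_apply_nonneg_of_null ht hxx hyy hxy
  rw [hv₂x x hx, hv₂x y hy] at h
  simp only [map_smul, LinearMap.smul_apply, smul_eq_mul]
  rw [mul_mul_mul_comm]
  exact mul_nonneg (mul_self_nonneg c) h

variable [FiniteDimensional ℝ V] {S₁ : Subsphere B m} {S₂ : Subsphere B l}

/- The orthogonal complement of `S₂.space ⊓ S₁.space` contains a timelike vector `v₂ + v₁` with
`v₁ ∈ S₁.perp` and `v₂ ∈ S₂.perp`; the hyperspheres with normal vectors `v₁` and `v₂` separate. -/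
theorem separable_of_euclideanOn (hB : IsPseudoEuclidean B) (hn : 1 ≤ n)
    (hV : Module.finrank ℝ V = n + 2) (h : EuclideanOn B (S₂.space ⊓ S₁.space)) :
    Separable n S₁ S₂ := by
  obtain ⟨t, ht, htt⟩ := (hB.pseudoEuclideanOn_orthogonal_iff.2 h).exists_timelike
  rw [hB.orthogonal_inf] at ht
  obtain ⟨v₂, hv₂, v₁, hv₁, rfl⟩ := Submodule.mem_sup.1 ht
  have hE₁ := hB.euclideanOn_orthogonal S₁.pseudoEuclidean
  have hE₂ := hB.euclideanOn_orthogonal S₂.pseudoEuclidean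
  have hv₁0 : v₁ ≠ 0 := by
    rintro rfl
    rw [add_zero] at htt
    exact htt.not_ge (hE₂.nonneg hv₂)
  have hv₂0 : v₂ ≠ 0 := by
    rintro rfl
    rw [zero_add] at htt
    exact htt.not_ge (hE₁.nonneg hv₁)
  obtain ⟨H₁, hH₁, hle₁⟩ := S₁.exists_hypersphere hB hn hV hv₁ hv₁0
  obtain ⟨H₂, hH₂, hle₂⟩ := S₂.exists_hypersphere hB hn hV hv₂ hv₂0
  refine ⟨H₁, H₂, (points_subset_iff hB).2 hle₁, (points_subset_iff hB).2 hle₂, ?_, fun _ =>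
    onOneSide_of_timelike_add hB ?_ ?_ htt⟩
  · refine quadricSection_inf.symm.trans (EuclideanOn.quadricSection_eq_empty fun x hx hx0 => ?_)
    rw [hH₁, hH₂, Submodule.mem_inf, mem_orthogonal_span_singleton,
      mem_orthogonal_span_singleton] at hx
    exact hB.pos_of_orthogonal_timelike htt
      (by rw [map_add, LinearMap.add_apply, hx.1, hx.2, add_zero]) hx0
  · rw [perp, hH₁, hB.orthogonal_orthogonal]
  · rw [perp, hH₂, hB.orthogonal_orthogonal]
    exact Submodule.mem_span_singleton_self v₂

/- If the spaces of the two hyperspheres do not meet in a euclidean subspace, they meet in a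
timelike line. Then `n = 1`, and a normal vector of `H₁` would be orthogonal to both spheres. -/
theorem euclideanOn_of_separable (hB : IsPseudoEuclidean B) (hn : 1 ≤ n)
    (hV : Module.finrank ℝ V = n + 2) (hS : Disjoint S₁.perp S₂.perp) (h : Separable n S₁ S₂) :
    EuclideanOn B (S₂.space ⊓ S₁.space) := by
  obtain ⟨H₁, H₂, hle₁, hle₂, hdisj, hside⟩ := h
  rw [points_subset_iff hB] at hle₁ hle₂
  have hempty : quadricSection B (H₁.space ⊓ H₂.space) = ∅ := quadricSection_inf.trans hdisj
  obtain hE | ⟨hP, hfin⟩ := hB.quadricSection_eq_empty_iff.1 hempty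
  · exact fun x hx => hE x ⟨hle₁ hx.2, hle₂ hx.1⟩
  exfalso
  have hn1 : n = 1 := by
    have hdim := Submodule.finrank_sup_add_finrank_inf_eq H₁.space H₂.space
    have hsup := Submodule.finrank_le (H₁.space ⊔ H₂.space)
    rw [H₁.finrank_eq, H₂.finrank_eq] at hdim
    omega
  obtain ⟨t, ⟨htH₁, htH₂⟩, ht⟩ := hP.exists_timelike
  have hperp : H₁.perp ≤ S₁.perp ⊓ S₂.perp :=
    le_inf (B.orthogonal_le hle₁)
      (((hside hn1).perp_le_perp hB htH₂ htH₁ ht).trans (B.orthogonal_le hle₂))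
  have hrank := H₁.finrank_perp hB hV
  rw [le_bot_iff.1 (hperp.trans hS.le_bot), finrank_bot] at hrank
  omega

theorem separable_iff_euclideanOn (hB : IsPseudoEuclidean B) (hn : 1 ≤ n)
    (hV : Module.finrank ℝ V = n + 2) (hS : Disjoint S₁.perp S₂.perp) :
    Separable n S₁ S₂ ↔ EuclideanOn B (S₂.space ⊓ S₁.space) :=
  ⟨euclideanOn_of_separable hB hn hV hS, separable_of_euclideanOn hB hn hV⟩

theorem interlaced_iff (hB : IsPseudoEuclidean B) (hn : 1 ≤ n)
    (hV : Module.finrank ℝ V = n + 2) (hS : Disjoint S₁.perp S₂.perp) :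
    Interlaced n S₁ S₂ ↔ PseudoEuclideanOn B (S₂.space ⊓ S₁.space) ∧
      Module.finrank ℝ ↥(S₂.space ⊓ S₁.space) = 1 := by
  rw [Interlaced, separable_iff_euclideanOn hB hn hV hS, points_inter_points,
    hB.quadricSection_eq_empty_iff]
  exact ⟨fun h => h.1.resolve_left h.2, fun h => ⟨.inr h, fun hE => hE.not_pseudoEuclideanOn h.1⟩⟩

theorem exists_points_inter_eq_points_iff (hB : IsPseudoEuclidean B) :
    (∃ (k : ℕ) (S : Subsphere B k), S₁.points ∩ S₂.points = S.points) ↔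
      PseudoEuclideanOn B (S₂.space ⊓ S₁.space) ∧
        2 ≤ Module.finrank ℝ ↥(S₂.space ⊓ S₁.space) := by
  rw [points_inter_points]
  refine ⟨fun ⟨k, S, hS⟩ => ?_, fun ⟨hP, h₂⟩ => ⟨_, ⟨_, hP, (Nat.sub_add_cancel h₂).symm⟩, rfl⟩⟩
  rw [← hB.quadricSection_nontrivial_iff, hS]
  exact hB.quadricSection_nontrivial S.pseudoEuclidean S.two_le_finrank_space

namespace GeneralPosition

theorem add_eq_of_points_inter_eq_points (h : GeneralPosition n S₁ S₂) (hB : IsPseudoEuclidean B)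
    (hn : 1 ≤ n) (hV : Module.finrank ℝ V = n + 2) {k : ℕ} {S : Subsphere B k}
    (hS : S₁.points ∩ S₂.points = S.points) : k + n = m + l := by
  obtain ⟨hP, h₂⟩ := (exists_points_inter_eq_points_iff hB).1 ⟨k, S, hS⟩
  rw [points_inter_points] at hS
  have hspace : S₂.space ⊓ S₁.space = S.space :=
    le_antisymm ((hB.quadricSection_subset_iff hP h₂).1 hS.le)
      ((hB.quadricSection_subset_iff S.pseudoEuclidean S.two_le_finrank_space).1 hS.ge)
  have hrank := h.finrank_inf hB hn hV
  rw [hspace, S.finrank_eq] at hrank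
  omega

theorem separable_tfae (h : GeneralPosition n S₁ S₂) (hB : IsPseudoEuclidean B) (hmn : m < n)
    (hV : Module.finrank ℝ V = n + 2) :
    List.TFAE [
      1 < eigenvalue S₁ S₂ 0,
      EuclideanOn B (S₂.space ⊓ S₁.space),
      Separable n S₁ S₂] := by
  have hS := h.disjoint_perp hB hmn.pos hV
  tfae_have 1 ↔ 2 := one_lt_eigenvalue_iff hB hV hmn hS
  tfae_have 3 ↔ 2 := separable_iff_euclideanOn hB hmn.pos hV hS
  tfae_finish

theorem points_inter_eq_points_tfae (h : GeneralPosition n S₁ S₂) (hB : IsPseudoEuclidean B)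
    (hmn : m < n) (hV : Module.finrank ℝ V = n + 2) :
    List.TFAE [
      eigenvalue S₁ S₂ 0 < 1 ∧ 1 < Module.finrank ℝ ↥(S₂.space ⊓ S₁.space),
      PseudoEuclideanOn B (S₂.space ⊓ S₁.space) ∧
        2 ≤ Module.finrank ℝ ↥(S₂.space ⊓ S₁.space),
      ∃ (k : ℕ) (S : Subsphere B k), S₁.points ∩ S₂.points = S.points,
      ∃ (k : ℕ) (S : Subsphere B k), k + n = m + l ∧ S₁.points ∩ S₂.points = S.points] := by
  tfae_have 1 ↔ 2 :=
    and_congr_left' (eigenvalue_lt_one_iff hB hV hmn (h.disjoint_perp hB hmn.pos hV))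
  tfae_have 3 ↔ 2 := exists_points_inter_eq_points_iff hB
  tfae_have 3 → 4 := fun ⟨k, S, hS⟩ =>
    ⟨k, S, h.add_eq_of_points_inter_eq_points hB hmn.pos hV hS, hS⟩
  tfae_have 4 → 3 := fun ⟨k, S, _, hS⟩ => ⟨k, S, hS⟩
  tfae_finish

theorem interlaced_tfae (h : GeneralPosition n S₁ S₂) (hB : IsPseudoEuclidean B) (hmn : m < n)
    (hV : Module.finrank ℝ V = n + 2) :
    List.TFAE [
      eigenvalue S₁ S₂ 0 < 1 ∧ Module.finrank ℝ ↥(S₂.space ⊓ S₁.space) = 1,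
      PseudoEuclideanOn B (S₂.space ⊓ S₁.space) ∧
        Module.finrank ℝ ↥(S₂.space ⊓ S₁.space) = 1,
      Interlaced n S₁ S₂] := by
  have hS := h.disjoint_perp hB hmn.pos hV
  tfae_have 1 ↔ 2 := and_congr_left' (eigenvalue_lt_one_iff hB hV hmn hS)
  tfae_have 3 ↔ 2 := interlaced_iff hB hmn.pos hV hS
  tfae_finish

theorem add_add_one_eq_of_interlaced (h : GeneralPosition n S₁ S₂) (hB : IsPseudoEuclidean B)
    (hn : 1 ≤ n) (hV : Module.finrank ℝ V = n + 2) (hI : Interlaced n S₁ S₂) :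
    m + l + 1 = n := by
  have hrank := h.finrank_inf hB hn hV
  rw [((interlaced_iff hB hn hV (h.disjoint_perp hB hn hV)).1 hI).2] at hrank
  omega

theorem points_inter_eq_singleton_tfae (h : GeneralPosition n S₁ S₂) (hB : IsPseudoEuclidean B)
    (hmn : m < n) (hV : Module.finrank ℝ V = n + 2) :
    List.TFAE [
      eigenvalue S₁ S₂ 0 = 1,
      IsotropicOn B (S₂.space ⊓ S₁.space),
      ∃ p, S₁.points ∩ S₂.points = {p}] := by
  rw [points_inter_points]
  tfae_have 1 ↔ 2 := eigenvalue_eq_one_iff hB hV hmn (h.disjoint_perp hB hmn.pos hV)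
  tfae_have 3 ↔ 2 := hB.exists_quadricSection_eq_singleton_iff
  tfae_finish

end GeneralPosition

end Position

end Subsphere

/-! ### Möbius invariants -/

section Similarity

theorem map_orthogonal_of_similarity {R V W : Type*} [CommRing R] [NoZeroDivisors R]
    [AddCommGroup V] [Module R V] [AddCommGroup W] [Module R W] {B : LinearMap.BilinForm R V}
    {C : LinearMap.BilinForm R W} {F : V ≃ₗ[R] W} {c : R} (hc : c ≠ 0)
    (hF : ∀ x y, C (F x) (F y) = c * B x y) (X : Submodule R V) :
    (B.orthogonal X).map F.toLinearMap = C.orthogonal (X.map F.toLinearMap) := by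
  ext y
  obtain ⟨x, rfl⟩ := F.surjective y
  constructor
  · rintro ⟨x', hx', hxx'⟩ _ ⟨z, hz, rfl⟩
    rw [← hxx']
    exact (hF z x').trans (mul_eq_zero_of_right c (hx' z hz))
  · exact fun h => ⟨x, fun z hz => (mul_eq_zero_iff_left hc).1 ((hF z x).symm.trans
      (h _ ⟨z, hz, rfl⟩)), rfl⟩

variable {V : Type*} [AddCommGroup V] [Module ℝ V] {B : LinearMap.BilinForm ℝ V}

theorem IsPseudoEuclidean.exists_similarity_of_null (hB : IsPseudoEuclidean B) {F : V ≃ₗ[ℝ] V}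
    (hF : ∀ x, B (F x) (F x) = 0 ↔ B x x = 0) :
    ∃ c : ℝ, c ≠ 0 ∧ ∀ x y, B (F x) (F y) = c * B x y := by
  obtain ⟨c, hc⟩ := hB.exists_eq_smul_of_null (C := B.comp F.toLinearMap F.toLinearMap)
    ⟨fun x y => hB.isSymm.eq (F x) (F y)⟩ fun x => (hF x).2
  have hc' : ∀ x y, B (F x) (F y) = c * B x y := LinearMap.congr_fun₂ hc
  obtain ⟨t, ht, -⟩ := hB.exists_timelike_orthogonal_pos
  refine ⟨c, ?_, hc'⟩
  rintro rfl
  exact ht.ne ((hF t).1 (by rw [hc', zero_mul]))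

theorem toPermHom_mk (F : V ≃ₗ[ℝ] V) {v : V} (hv : v ≠ 0) :
    MulAction.toPermHom (V ≃ₗ[ℝ] V) (ℙ ℝ V) F (.mk ℝ v hv) =
      .mk ℝ (F v) (F.map_ne_zero_iff.2 hv) :=
  rfl

theorem toPermHom_mem_moebiusGroup_iff {F : V ≃ₗ[ℝ] V} :
    MulAction.toPermHom (V ≃ₗ[ℝ] V) (ℙ ℝ V) F ∈ moebiusGroup B ↔
      ∀ x, B (F x) (F x) = 0 ↔ B x x = 0 := by
  rw [moebiusGroup, Subgroup.mem_inf, and_iff_right ⟨F, rfl⟩,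
    MulAction.mem_stabilizer_set]
  refine ⟨fun h x => ?_, fun h p => ?_⟩
  · rcases eq_or_ne x 0 with rfl | hx
    · simp
    simpa [mk_mem_quadric] using h (.mk ℝ x hx)
  · induction p using Projectivization.ind with
    | h v hv => rw [Equiv.Perm.smul_def, toPermHom_mk, mk_mem_quadric, mk_mem_quadric, h]

theorem image_quadricSection {F : V ≃ₗ[ℝ] V} (hF : ∀ x, B (F x) (F x) = 0 ↔ B x x = 0)
    (X : Submodule ℝ V) :
    MulAction.toPermHom (V ≃ₗ[ℝ] V) (ℙ ℝ V) F '' quadricSection B X =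
      quadricSection B (X.map F.toLinearMap) := by
  ext p
  obtain ⟨q, rfl⟩ := (MulAction.toPermHom (V ≃ₗ[ℝ] V) (ℙ ℝ V) F).surjective p
  rw [(Equiv.injective _).mem_set_image]
  induction q using Projectivization.ind with
  | h v hv => simp [mk_mem_quadricSection, hF]

end Similarity

namespace Subsphere

variable {V : Type*} [AddCommGroup V] [Module ℝ V] {B : LinearMap.BilinForm ℝ V} {m l n : ℕ}

theorem image_points_eq_iff (hB : IsPseudoEuclidean B) {S T : Subsphere B m} {F : V ≃ₗ[ℝ] V}
    (hF : ∀ x, B (F x) (F x) = 0 ↔ B x x = 0) :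
    MulAction.toPermHom (V ≃ₗ[ℝ] V) (ℙ ℝ V) F '' S.points = T.points ↔
      S.space.map F.toLinearMap = T.space := by
  have himage : MulAction.toPermHom (V ≃ₗ[ℝ] V) (ℙ ℝ V) F '' S.points =
      quadricSection B (S.space.map F.toLinearMap) := image_quadricSection hF S.space
  rw [himage]
  refine ⟨fun h => ?_, fun h => congrArg (quadricSection B) h⟩
  have hrank : Module.finrank ℝ (S.space.map F.toLinearMap) = m + 2 :=
    (LinearEquiv.finrank_map_eq F S.space).trans S.finrank_eq
  have : FiniteDimensional ℝ (S.space.map F.toLinearMap) :=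
    Module.finite_of_finrank_pos (by omega)
  exact (Submodule.eq_of_le_of_finrank_eq ((hB.quadricSection_subset_iff T.pseudoEuclidean
    T.two_le_finrank_space).1 h.ge) (T.finrank_eq.trans hrank.symm)).symm

theorem moebiusEquivalent_iff (hB : IsPseudoEuclidean B) {S₁ T₁ : Subsphere B m}
    {S₂ T₂ : Subsphere B l} :
    MoebiusEquivalent S₁ S₂ T₁ T₂ ↔ ∃ F : V ≃ₗ[ℝ] V, (∀ x, B (F x) (F x) = 0 ↔ B x x = 0) ∧
      S₁.space.map F.toLinearMap = T₁.space ∧ S₂.space.map F.toLinearMap = T₂.space := by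
  constructor
  · rintro ⟨g, hg, h₁, h₂⟩
    obtain ⟨F, rfl⟩ := hg.1
    have hF := toPermHom_mem_moebiusGroup_iff.1 hg
    exact ⟨F, hF, (image_points_eq_iff hB hF).1 h₁, (image_points_eq_iff hB hF).1 h₂⟩
  · rintro ⟨F, hF, h₁, h₂⟩
    exact ⟨_, toPermHom_mem_moebiusGroup_iff.2 hF, (image_points_eq_iff hB hF).2 h₁,
      (image_points_eq_iff hB hF).2 h₂⟩

section Invariance

variable {W : Type*} [AddCommGroup W] [Module ℝ W] {C : LinearMap.BilinForm ℝ W}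
  {F : V ≃ₗ[ℝ] W}

theorem proj_ofSubmodules {S₁ : Subsphere B m} {S₂ : Subsphere B l} {T₁ : Subsphere C m}
    {T₂ : Subsphere C l} (h₂ : S₂.space.map F.toLinearMap = T₂.space)
    (hp₁ : S₁.perp.map F.toLinearMap = T₁.perp) (hp₂ : S₂.perp.map F.toLinearMap = T₂.perp)
    (x : S₁.perp) :
    proj T₁ T₂ (F.ofSubmodules _ _ hp₁ x) = F.ofSubmodules _ _ hp₂ (proj S₁ S₂ x) := by
  refine proj_eq_of_sub_mem T₁ T₂ ?_
  rw [LinearEquiv.ofSubmodules_apply, LinearEquiv.ofSubmodules_apply, ← map_sub, ← h₂]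
  exact ⟨_, coproj_mem_space S₁ S₂ x, rfl⟩

theorem eigenvalue_eq_of_similarity [FiniteDimensional ℝ V] [FiniteDimensional ℝ W]
    {S₁ : Subsphere B m} {S₂ : Subsphere B l} {T₁ : Subsphere C m} {T₂ : Subsphere C l} {c : ℝ}
    (hc : c ≠ 0) (hF : ∀ x y, C (F x) (F y) = c * B x y)
    (h₁ : S₁.space.map F.toLinearMap = T₁.space) (h₂ : S₂.space.map F.toLinearMap = T₂.space) :
    eigenvalue S₁ S₂ = eigenvalue T₁ T₂ := by
  have hp₁ : S₁.perp.map F.toLinearMap = T₁.perp := by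
    rw [perp, map_orthogonal_of_similarity hc hF, h₁]
  have hp₂ : S₂.perp.map F.toLinearMap = T₂.perp := by
    rw [perp, map_orthogonal_of_similarity hc hF, h₂]
  have hconj : opA T₁ T₂ = (F.ofSubmodules _ _ hp₁).conj (opA S₁ S₂) := by
    ext y
    obtain ⟨x, rfl⟩ := (F.ofSubmodules _ _ hp₁).surjective y
    rw [LinearEquiv.conj_apply_apply, LinearEquiv.symm_apply_apply, opA, LinearMap.comp_apply,
      proj_ofSubmodules h₂ hp₁ hp₂, proj_ofSubmodules h₁ hp₂ hp₁]
    rfl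
  funext i
  rw [eigenvalue, eigenvalue, hconj, LinearEquiv.charpoly_conj]

end Invariance

end Subsphere

section WittPair

theorem linearIndependent_sumElim_of_disjoint {R V ι κ : Type*} [Ring R] [AddCommGroup V]
    [Module R V] {X Y : Submodule R V} (h : Disjoint X Y) (a : Module.Basis ι R X)
    (b : Module.Basis κ R Y) :
    LinearIndependent R (Sum.elim (fun i => (a i : V)) fun j => (b j : V)) := by
  refine (a.linearIndependent.map' X.subtype X.ker_subtype).sum_type
    (b.linearIndependent.map' Y.subtype Y.ker_subtype) (h.mono ?_ ?_) <;> rw [Submodule.span_le]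
  · rintro _ ⟨i, rfl⟩
    exact (a i).2
  · rintro _ ⟨j, rfl⟩
    exact (b j).2

theorem map_eq_of_forall_apply_eq {R V W : Type*} [Semiring R] [AddCommMonoid V] [Module R V]
    [AddCommMonoid W] [Module R W] {X : Submodule R V} {Y : Submodule R W} {F : V →ₗ[R] W}
    (e : X ≃ₗ[R] Y) (h : ∀ x : X, F x = e x) : X.map F = Y := by
  have hF : F ∘ₗ X.subtype = Y.subtype ∘ₗ e.toLinearMap := LinearMap.ext h
  rw [← X.range_subtype, ← LinearMap.range_comp, hF, LinearEquiv.range_comp, Y.range_subtype]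

variable {V : Type*} [AddCommGroup V] [Module ℝ V] [FiniteDimensional ℝ V]
  {B : LinearMap.BilinForm ℝ V}

theorem IsPseudoEuclidean.exists_isometryEquiv_map_eq_map_eq (hB : IsPseudoEuclidean B)
    {X Y X' Y' : Submodule ℝ V} (hXY : Disjoint X Y) (hXY' : Disjoint X' Y')
    (e : (B.restrict X).IsometryEquiv (B.restrict X'))
    (g : (B.restrict Y).IsometryEquiv (B.restrict Y'))
    (heg : ∀ x y, B (e x) (g y) = B (x : V) y) :
    ∃ R : B.IsometryEquiv B, X.map R.toLinearMap = X' ∧ Y.map R.toLinearMap = Y' := by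
  let a := Module.finBasis ℝ X
  let b := Module.finBasis ℝ Y
  obtain ⟨R, hR⟩ := hB.exists_isometryEquiv_extending
    (linearIndependent_sumElim_of_disjoint hXY a b)
    (linearIndependent_sumElim_of_disjoint hXY' (a.map e.toLinearEquiv) (b.map g.toLinearEquiv))
    (by
      rintro (i | i) (j | j)
      · exact (e.map_app (a j) (a i)).symm
      · exact (heg (a i) (b j)).symm
      · exact (hB.isSymm.eq _ _).trans ((heg (a j) (b i)).symm.trans (hB.isSymm.eq _ _))
      · exact (g.map_app (b j) (b i)).symm)
  have hX : R.toLinearMap ∘ₗ X.subtype = X'.subtype ∘ₗ e.toLinearMap := a.ext fun i => hR (.inl i)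
  have hY : R.toLinearMap ∘ₗ Y.subtype = Y'.subtype ∘ₗ g.toLinearMap := b.ext fun j => hR (.inr j)
  exact ⟨R, map_eq_of_forall_apply_eq e.toLinearEquiv (LinearMap.congr_fun hX),
    map_eq_of_forall_apply_eq g.toLinearEquiv (LinearMap.congr_fun hY)⟩

end WittPair

namespace Subsphere

section Completeness

variable {V : Type*} [AddCommGroup V] [Module ℝ V] [FiniteDimensional ℝ V]
  {B : LinearMap.BilinForm ℝ V} {m l n : ℕ} {S₁ T₁ : Subsphere B m} {S₂ T₂ : Subsphere B l}

theorem exists_isometryEquiv_opA (hB : IsPseudoEuclidean B) (hV : Module.finrank ℝ V = n + 2)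
    (h : ∀ i < n - m, eigenvalue S₁ S₂ i = eigenvalue T₁ T₂ i) :
    ∃ e : (B.restrict S₁.perp).IsometryEquiv (B.restrict T₁.perp),
      ∀ x, e (opA S₁ S₂ x) = opA T₁ T₂ (e x) := by
  obtain ⟨a, ha, haα, -⟩ := exists_eigenbasis hB hV S₁ S₂
  obtain ⟨c, hc, hcα, -⟩ := exists_eigenbasis hB hV T₁ T₂
  let e := a.equiv c (.refl _)
  have hform : (B.restrict T₁.perp).comp e.toLinearMap e.toLinearMap = B.restrict S₁.perp :=
    a.ext fun i => a.ext fun j => by simp [e, ha, hc]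
  have hopA : e.toLinearMap ∘ₗ opA S₁ S₂ = opA T₁ T₂ ∘ₗ e.toLinearMap :=
    a.ext fun i => by simp [e, haα, hcα, h i i.2]
  exact ⟨{ e with map_app' := fun x y => LinearMap.congr_fun₂ hform x y },
    LinearMap.congr_fun hopA⟩

theorem exists_isometryEquiv_proj (hB : IsPseudoEuclidean B) (hV : Module.finrank ℝ V = n + 2)
    {e : (B.restrict S₁.perp).IsometryEquiv (B.restrict T₁.perp)}
    (he : ∀ x, e (opA S₁ S₂ x) = opA T₁ T₂ (e x)) :
    ∃ g : (B.restrict S₂.perp).IsometryEquiv (B.restrict T₂.perp),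
      ∀ x, g (proj S₁ S₂ x) = proj T₁ T₂ (e x) := by
  let a := Module.finBasis ℝ S₁.perp
  have hgram : ∀ x y, B (proj S₁ S₂ x) (proj S₁ S₂ y) =
      B (proj T₁ T₂ (e x)) (proj T₁ T₂ (e y)) := fun x y => by
    rw [← apply_opA hB.isSymm, ← apply_opA hB.isSymm, ← he]
    exact (e.map_app _ _).symm
  have hpos : ∀ {S : Subsphere B l} (x : S.perp), x ≠ 0 → 0 < B.restrict S.perp x x :=
    fun {S} x hx => hB.euclideanOn_orthogonal S.pseudoEuclidean x x.2 (by simpa using hx)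
  obtain ⟨g, hg⟩ := exists_isometryEquiv_of_gram_eq (hB.isSymm.restrict S₂.perp) hpos
    (hB.isSymm.restrict T₂.perp) hpos ((S₂.finrank_perp hB hV).trans (T₂.finrank_perp hB hV).symm)
    (x := fun i => proj S₁ S₂ (a i)) (y := fun i => proj T₁ T₂ (e (a i)))
    fun i j => hgram (a i) (a j)
  have hproj : g.toLinearMap ∘ₗ proj S₁ S₂ = proj T₁ T₂ ∘ₗ e.toLinearMap := a.ext hg
  exact ⟨g, LinearMap.congr_fun hproj⟩

theorem moebiusEquivalent_of_map_perp_eq (hB : IsPseudoEuclidean B) (R : B.IsometryEquiv B)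
    (h₁ : S₁.perp.map R.toLinearMap = T₁.perp) (h₂ : S₂.perp.map R.toLinearMap = T₂.perp) :
    MoebiusEquivalent S₁ S₂ T₁ T₂ := by
  have hR : ∀ x y, B (R.toLinearEquiv x) (R.toLinearEquiv y) = B x y := fun x y => R.map_app y x
  have hspace : ∀ {k : ℕ} {S T : Subsphere B k}, S.perp.map R.toLinearMap = T.perp →
      S.space.map R.toLinearMap = T.space := fun {k S T} h => by
    rw [← hB.orthogonal_orthogonal S.space, map_orthogonal_of_similarity one_ne_zero
      fun x y => (hR x y).trans (one_mul _).symm, h, hB.orthogonal_orthogonal]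
  exact (moebiusEquivalent_iff hB).2
    ⟨R.toLinearEquiv, fun x => by rw [hR], hspace h₁, hspace h₂⟩

theorem moebiusEquivalent_iff_eigenvalue_eq (hB : IsPseudoEuclidean B)
    (hV : Module.finrank ℝ V = n + 2) (hS : Disjoint S₁.perp S₂.perp)
    (hT : Disjoint T₁.perp T₂.perp) :
    MoebiusEquivalent S₁ S₂ T₁ T₂ ↔ ∀ i < n - m, eigenvalue S₁ S₂ i = eigenvalue T₁ T₂ i := by
  constructor
  · intro h i _
    obtain ⟨F, hF, h₁, h₂⟩ := (moebiusEquivalent_iff hB).1 h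
    obtain ⟨c, hc, hFc⟩ := hB.exists_similarity_of_null hF
    rw [eigenvalue_eq_of_similarity hc hFc h₁ h₂]
  · intro h
    obtain ⟨e, he⟩ := exists_isometryEquiv_opA hB hV h
    obtain ⟨g, hg⟩ := exists_isometryEquiv_proj hB hV he
    have heg : ∀ x y, B (e x) (g y) = B (x : V) y := fun x y => by
      rw [← apply_proj T₁ T₂, ← hg, ← apply_proj S₁ S₂]
      exact g.map_app _ _
    obtain ⟨R, h₁, h₂⟩ := hB.exists_isometryEquiv_map_eq_map_eq hS hT e g heg
    exact moebiusEquivalent_of_map_perp_eq hB R h₁ h₂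

end Completeness

end Subsphere

end Moebius

theorem mainTheorem1_general {V : Type*} [AddCommGroup V] [Module ℝ V] [FiniteDimensional ℝ V]
    (n m l : ℕ) (hmn : m < n)
    (B : LinearMap.BilinForm ℝ V) (hB : IsPseudoEuclidean B)
    (hV : Module.finrank ℝ V = n + 2) :
    (∀ (S₁ : Subsphere B m) (S₂ : Subsphere B l), GeneralPosition n S₁ S₂ →
      (∀ x y : S₁.perp, B (opA S₁ S₂ x) y = B x (opA S₁ S₂ y)) ∧
      (∃ a : Module.Basis (Fin (n - m)) ℝ S₁.perp,
        (∀ i j, B (a i) (a j) = if i = j then 1 else 0) ∧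
        ∀ i : Fin (n - m), opA S₁ S₂ (a i) = eigenvalue S₁ S₂ i • a i) ∧
      (∀ i j : ℕ, i ≤ j → j < n - m → eigenvalue S₁ S₂ j ≤ eigenvalue S₁ S₂ i) ∧
      (∀ i < n - m, 0 ≤ eigenvalue S₁ S₂ i) ∧
      List.TFAE [
        1 < eigenvalue S₁ S₂ 0,
        EuclideanOn B (S₂.space ⊓ S₁.space),
        Separable n S₁ S₂] ∧
      (eigenvalue S₁ S₂ 0 < 1 ↔ PseudoEuclideanOn B (S₂.space ⊓ S₁.space)) ∧
      List.TFAE [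
        eigenvalue S₁ S₂ 0 < 1 ∧ 1 < Module.finrank ℝ ↥(S₂.space ⊓ S₁.space),
        PseudoEuclideanOn B (S₂.space ⊓ S₁.space) ∧
          2 ≤ Module.finrank ℝ ↥(S₂.space ⊓ S₁.space),
        ∃ (k : ℕ) (S : Subsphere B k), S₁.points ∩ S₂.points = S.points,
        ∃ (k : ℕ) (S : Subsphere B k), k + n = m + l ∧ S₁.points ∩ S₂.points = S.points] ∧
      List.TFAE [
        eigenvalue S₁ S₂ 0 < 1 ∧ Module.finrank ℝ ↥(S₂.space ⊓ S₁.space) = 1,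
        PseudoEuclideanOn B (S₂.space ⊓ S₁.space) ∧
          Module.finrank ℝ ↥(S₂.space ⊓ S₁.space) = 1,
        Interlaced n S₁ S₂] ∧
      (Interlaced n S₁ S₂ → m + l + 1 = n) ∧
      List.TFAE [
        eigenvalue S₁ S₂ 0 = 1,
        IsotropicOn B (S₂.space ⊓ S₁.space),
        ∃ p, S₁.points ∩ S₂.points = {p}]) ∧
    (∀ (S₁ T₁ : Subsphere B m) (S₂ T₂ : Subsphere B l),
      GeneralPosition n S₁ S₂ → GeneralPosition n T₁ T₂ →
      (MoebiusEquivalent S₁ S₂ T₁ T₂ ↔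
        ∀ i < n - m, eigenvalue S₁ S₂ i = eigenvalue T₁ T₂ i)) := by
  refine ⟨fun S₁ S₂ h => ?_, fun S₁ T₁ S₂ T₂ hS hT => moebiusEquivalent_iff_eigenvalue_eq hB hV
    (hS.disjoint_perp hB hmn.pos hV) (hT.disjoint_perp hB hmn.pos hV)⟩
  obtain ⟨a, ha, haα, hanti⟩ := exists_eigenbasis hB hV S₁ S₂
  exact ⟨apply_opA_eq_apply_opA hB.isSymm, ⟨a, ha, haα⟩,
    fun i j hij hj => hanti (a := ⟨i, hij.trans_lt hj⟩) (b := ⟨j, hj⟩) hij,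
    fun i hi => eigenvalue_nonneg hB hV ⟨i, hi⟩,
    h.separable_tfae hB hmn hV,
    eigenvalue_lt_one_iff hB hV hmn (h.disjoint_perp hB hmn.pos hV),
    h.points_inter_eq_points_tfae hB hmn hV,
    h.interlaced_tfae hB hmn hV,
    h.add_add_one_eq_of_interlaced hB hmn.pos hV,
    h.points_inter_eq_singleton_tfae hB hmn hV⟩

theorem mainTheorem1 {V : Type*} [AddCommGroup V] [Module ℝ V] [FiniteDimensional ℝ V]
    (n m l : ℕ) (hmn : m < n) (hlm : l ≤ m)
    (B : LinearMap.BilinForm ℝ V) (hB : IsPseudoEuclidean B)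
    (hV : Module.finrank ℝ V = n + 2) :
    -- the eigenvalues of the self-adjoint operator `A`, and the four mutual positions
    (∀ (S₁ : Subsphere B m) (S₂ : Subsphere B l), GeneralPosition n S₁ S₂ →
      (∀ x y : S₁.perp, B (opA S₁ S₂ x) y = B x (opA S₁ S₂ y)) ∧
      (∃ a : Module.Basis (Fin (n - m)) ℝ S₁.perp,
        (∀ i j, B (a i) (a j) = if i = j then 1 else 0) ∧
        ∀ i : Fin (n - m), opA S₁ S₂ (a i) = eigenvalue S₁ S₂ i • a i) ∧
      (∀ i j : ℕ, i ≤ j → j < n - m → eigenvalue S₁ S₂ j ≤ eigenvalue S₁ S₂ i) ∧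
      (∀ i < n - m, 0 ≤ eigenvalue S₁ S₂ i) ∧
      List.TFAE [
        1 < eigenvalue S₁ S₂ 0,
        EuclideanOn B (S₂.space ⊓ S₁.space),
        Separable n S₁ S₂] ∧
      (eigenvalue S₁ S₂ 0 < 1 ↔ PseudoEuclideanOn B (S₂.space ⊓ S₁.space)) ∧
      List.TFAE [
        eigenvalue S₁ S₂ 0 < 1 ∧ 1 < Module.finrank ℝ ↥(S₂.space ⊓ S₁.space),
        PseudoEuclideanOn B (S₂.space ⊓ S₁.space) ∧
          2 ≤ Module.finrank ℝ ↥(S₂.space ⊓ S₁.space),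
        ∃ (k : ℕ) (S : Subsphere B k), S₁.points ∩ S₂.points = S.points,
        ∃ (k : ℕ) (S : Subsphere B k), k + n = m + l ∧ S₁.points ∩ S₂.points = S.points] ∧
      List.TFAE [
        eigenvalue S₁ S₂ 0 < 1 ∧ Module.finrank ℝ ↥(S₂.space ⊓ S₁.space) = 1,
        PseudoEuclideanOn B (S₂.space ⊓ S₁.space) ∧
          Module.finrank ℝ ↥(S₂.space ⊓ S₁.space) = 1,
        Interlaced n S₁ S₂] ∧
      (Interlaced n S₁ S₂ → m + l + 1 = n) ∧
      List.TFAE [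
        eigenvalue S₁ S₂ 0 = 1,
        IsotropicOn B (S₂.space ⊓ S₁.space),
        ∃ p, S₁.points ∩ S₂.points = {p}]) ∧
    -- the eigenvalues are a complete system of invariants
    (∀ (S₁ T₁ : Subsphere B m) (S₂ T₂ : Subsphere B l),
      GeneralPosition n S₁ S₂ → GeneralPosition n T₁ T₂ →
      (MoebiusEquivalent S₁ S₂ T₁ T₂ ↔
        ∀ i < n - m, eigenvalue S₁ S₂ i = eigenvalue T₁ T₂ i)) :=
  mainTheorem1_general n m l hmn B hB hV
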